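/- Let $d\ge 1$, $\alpha\in(0,\infty)^d$, $p\in(0,1)$. Write $|z|=\sum_i z_i$, $(a)_n=a(a+1)\cdots(a+n-1)$, $n'=(n_1,\dots,n_{d-1})$ for $n\in\mathbb N^d$ (where $0\in\mathbb N$), $\gamma_{a,b}$ for the Gamma law with density $z^{a-1}e^{-z/b}/(\Gamma(a)b^a)$ on $z>0$, $\gamma^d_{\alpha,b}=\bigotimes_i\gamma_{\alpha_i,b}$, $NB_{a,p}(m)=\frac{(a)_m}{m!}p^m(1-p)^a$, $NB^d_{\alpha,p}(m)=\prod_i NB_{\alpha_i,p}(m_i)$, $B_\lambda(m)=\frac{|m|!}{m_1!\cdots m_d!}\lambda^m$, and $D_\alpha$ for the Dirichlet law on the simplex. Univariate polynomials: the Laguerre polynomials $L_n^a(y)=\frac{(a)_n}{n!}\,{}_1F_1(-n;a;y)$; the Jacobi polynomials $R_n^{a,b}$ on $[0,1]$, orthogonal for the Beta$(a,b)$ law with $R_n^{a,b}(1)=1$; the Meixner polynomials $\tilde M_n^{a,p}(t)=\int_0^\infty L_n^a\!\left(z\tfrac{1-p}{p}\right)\gamma_{a+t,p}(dz)$ for $a+t>0$.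 Multivariate Jacobi and Hahn polynomials: for $n\in\mathbb N^{d-1}$, $$R_n^\alpha(x)=\prod_{j=1}^{d-1}R_{n_j}^{\alpha_j,\,A_j+2N_j}\!\left(\frac{x_j}{1-s_{j-1}}\right)(1-s_{j-1})^{n_j},\qquad \tilde q_n^\alpha(m)=\int R_n^\alpha\,dD_{\alpha+m},$$ where $s_{j}=\sum_{i\le j}x_i$, $A_j=\sum_{i>j}\alpha_i$, $N_j=\sum_{i>j}n_i$. Let $(L_n,M_n)_{n\in\mathbb N^d}$ be either of the following two multiple Laguerre and Meixner systems: (a) $L_n(y)=\prod_{i=1}^d L_{n_i}^{\alpha_i}(y_i)$ and $M_n(m)=\prod_{i=1}^d\tilde M_{n_i}^{\alpha_i,p}(m_i)$; (b) $L_n(y)=L_{n_d}^{|\alpha|+2|n'|}(|y|)\,|y|^{|n'|}R_{n'}^\alpha(y/|y|)$ and $M_n(m)=(1-p)^{|n'|}\tilde M_{n_d}^{|\alpha|+2|n'|,p}(|m|-|n'|)\,(|\alpha|+|m|)_{|n'|}\,\tilde q_{n'}^\alpha(m)$. For $r\in\mathbb N^d$ put $$c_r=\int L_r^2\,d\gamma^d_{\alpha,1},\qquad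 \rho_r(\alpha,p)^{-1}=\sum_{m\in\mathbb N^d}NB^d_{\alpha,p}(m)\,M_r(m)^2 .$$ Then both quantities are finite and positive, and for every $\lambda\in[0,\infty)^d$ $$L_r\!\left(\lambda\,\frac{1-p}{p}\right)=c_r\,\rho_r(\alpha,p)\sum_{m\in\mathbb N^d}\frac{e^{-|\lambda|}}{|m|!}\,M_r(m)\,B_\lambda(m),$$ the series converging absolutely. (If $L_r$ and, by the same factor, $M_r$ are rescaled so that $c_r=1$, the constant is $\rho_r(\alpha,p)$.) So the multiple Meixner polynomials are rescaled Bernstein–Bézier coefficients of the multiple Laguerre polynomials. -/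

import Mathlib

open MeasureTheory ProbabilityTheory

namespace MultiPoly

noncomputable section

/-- The rising factorial `a (a + 1) ⋯ (a + n - 1)`; it equals `Γ(a + n) / Γ(a)` for `a > 0`. -/
def rising (a : ℝ) (n : ℕ) : ℝ := (ascPochhammer ℝ n).eval a

/-- The Laguerre polynomial, with the positive parameter `a` of its Gamma weight:
`((a)_n / n!) ₁F₁(-n; a; y)`. The series terminates at index `n`. -/
def laguerre (n : ℕ) (a y : ℝ) : ℝ :=
  rising a n / (n.factorial : ℝ) *
    ∑ i ∈ Finset.range (n + 1),
      rising (-(n : ℝ)) i / (rising a i * (i.factorial : ℝ)) * y ^ i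

/-- The Jacobi polynomial on `[-1, 1]`, orthogonal for the weight `(1 - x)^a (1 + x)^b`:
`((a + 1)_n / n!) ₂F₁(-n, n + a + b + 1; a + 1; (1 - x) / 2)`. -/
def jacobi (n : ℕ) (a b x : ℝ) : ℝ :=
  rising (a + 1) n / (n.factorial : ℝ) *
    ∑ i ∈ Finset.range (n + 1),
      rising (-(n : ℝ)) i * rising (n + a + b + 1) i / (rising (a + 1) i * (i.factorial : ℝ)) *
        ((1 - x) / 2) ^ i

/-- The Jacobi polynomial shifted to `[0, 1]`, orthogonal for the Beta distribution with
parameters `a, b`, and standardized to have value `1` at `x = 1`. -/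
def jacobiR (n : ℕ) (a b x : ℝ) : ℝ :=
  jacobi n (b - 1) (a - 1) (2 * x - 1) / jacobi n (b - 1) (a - 1) 1

/-- The multivariate Jacobi polynomial on the simplex (here `d = k + 1`, and `x` collects the
first `d - 1` coordinates). With `s_{j-1} = ∑_{i<j} x_i`, `A_j = ∑_{i>j} α_i` and
`N_j = ∑_{i>j} n_i` it is the product over `j` of
`R_{n_j}^{α_j, A_j + 2 N_j} (x_j / (1 - s_{j-1})) (1 - s_{j-1})^{n_j}`. -/
def multiJacobi {k : ℕ} (α : Fin (k + 1) → ℝ) (n : Fin k → ℕ) (x : Fin k → ℝ) : ℝ :=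
  ∏ j : Fin k,
    jacobiR (n j) (α j.castSucc)
        ((∑ i ∈ Finset.Ioi j.castSucc, α i) + 2 * ((∑ i ∈ Finset.Ioi j, n i : ℕ) : ℝ))
        (x j / (1 - ∑ i ∈ Finset.Iio j, x i)) *
      (1 - ∑ i ∈ Finset.Iio j, x i) ^ (n j)

/-- The Gamma distribution with shape `a` and scale `b`, of density
`z^(a-1) e^(-z/b) / (Γ(a) b^a)` on `z > 0` (Mathlib's parameter is the rate `1 / b`). -/
def gammaScale (a b : ℝ) : Measure ℝ := gammaMeasure a b⁻¹

/-- The law of independent Gamma variables with shapes `α i` and common scale `b`. -/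
def gammaPi {k : ℕ} (α : Fin k → ℝ) (b : ℝ) : Measure (Fin k → ℝ) :=
  Measure.pi fun i => gammaScale (α i) b

/-- The simplex `{x : x_i ≥ 0, ∑ x_i ≤ 1}`. -/
def simplex (k : ℕ) : Set (Fin k → ℝ) := {x | (∀ i, 0 ≤ x i) ∧ ∑ i, x i ≤ 1}

/-- The Dirichlet distribution on the simplex, in the first `d - 1` of `d = k + 1` coordinates. -/
def dirichlet {k : ℕ} (α : Fin (k + 1) → ℝ) : Measure (Fin k → ℝ) :=
  (volume.restrict (simplex k)).withDensity fun x =>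
    ENNReal.ofReal
      (Real.Gamma (∑ i, α i) / (∏ i, Real.Gamma (α i)) *
        (∏ i : Fin k, x i ^ (α i.castSucc - 1)) *
          (1 - ∑ i, x i) ^ (α (Fin.last k) - 1))

/-- The multinomial (Bernstein) function `(|m|! / (m_1! ⋯ m_d!)) x^m`. -/
def bernsteinB {d : ℕ} (x : Fin d → ℝ) (m : Fin d → ℕ) : ℝ :=
  (Nat.multinomial Finset.univ m : ℝ) * ∏ i, x i ^ m i

/-- The Negative Binomial mass function `((a)_m / m!) p^m (1 - p)^a`. -/
def negBin (a p : ℝ) (m : ℕ) : ℝ :=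
  rising a m / (m.factorial : ℝ) * p ^ m * (1 - p) ^ a

/-- The joint mass function of independent Negative Binomial variables. -/
def negBinPi {d : ℕ} (α : Fin d → ℝ) (p : ℝ) (m : Fin d → ℕ) : ℝ :=
  ∏ i, negBin (α i) p (m i)

/-- The univariate Meixner polynomial: the posterior mixture, over the Gamma distribution with
shape `a + t` and scale `p`, of the rescaled Laguerre polynomial. The argument `t` is real
(with `a + t > 0`), because below it may be a negative integer. -/
def meixner (n : ℕ) (a p t : ℝ) : ℝ :=
  ∫ z, laguerre n a (z * ((1 - p) / p)) ∂(gammaScale (a + t) p)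

/-- The multivariate Hahn polynomial `∫ R_n^α dD_{α + r}`: the posterior mixture of the
multivariate Jacobi polynomial. -/
def multiHahn {k : ℕ} (α : Fin (k + 1) → ℝ) (n : Fin k → ℕ) (r : Fin (k + 1) → ℕ) : ℝ :=
  ∫ x, multiJacobi α n x ∂(dirichlet fun i => α i + (r i : ℝ))

/-- The product multiple Laguerre polynomial. -/
def multiLaguerre {k : ℕ} (α : Fin (k + 1) → ℝ) (n : Fin (k + 1) → ℕ)
    (y : Fin (k + 1) → ℝ) : ℝ :=
  ∏ i, laguerre (n i) (α i) (y i)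

/-- The multiple Laguerre polynomial built on the multivariate Jacobi polynomial:
`L_{n_d}^{|α| + 2|n'|}(|y|) |y|^{|n'|} R_{n'}^α(y / |y|)`, with `n' = (n_1, …, n_{d-1})`. -/
def multiLaguerreStar {k : ℕ} (α : Fin (k + 1) → ℝ) (n : Fin (k + 1) → ℕ)
    (y : Fin (k + 1) → ℝ) : ℝ :=
  laguerre (n (Fin.last k)) ((∑ i, α i) + 2 * ((∑ j : Fin k, n j.castSucc : ℕ) : ℝ)) (∑ i, y i) *
    (∑ i, y i) ^ (∑ j : Fin k, n j.castSucc) *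
    multiJacobi α (fun j => n j.castSucc) (fun j => y j.castSucc / ∑ i, y i)

/-- The product multiple Meixner polynomial. -/
def multiMeixner {k : ℕ} (α : Fin (k + 1) → ℝ) (p : ℝ) (n : Fin (k + 1) → ℕ)
    (m : Fin (k + 1) → ℕ) : ℝ :=
  ∏ i, meixner (n i) (α i) p (m i)

/-- The multiple Meixner polynomial built on the multivariate Hahn polynomial:
`(1-p)^{|n'|} M_{n_d}^{|α| + 2|n'|, p}(|m| - |n'|) (|α| + |m|)_{|n'|} q_{n'}^α(m)`. -/
def multiMeixnerStar {k : ℕ} (α : Fin (k + 1) → ℝ) (p : ℝ) (n : Fin (k + 1) → ℕ)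
    (m : Fin (k + 1) → ℕ) : ℝ :=
  (1 - p) ^ (∑ j : Fin k, n j.castSucc) *
    meixner (n (Fin.last k)) ((∑ i, α i) + 2 * ((∑ j : Fin k, n j.castSucc : ℕ) : ℝ)) p
      (((∑ i, m i : ℕ) : ℝ) - ((∑ j : Fin k, n j.castSucc : ℕ) : ℝ)) *
    rising ((∑ i, α i) + ((∑ i, m i : ℕ) : ℝ)) (∑ j : Fin k, n j.castSucc) *
    multiHahn α (fun j => n j.castSucc) m

end

end MultiPoly

namespace MultiPoly

/-! ### Rising factorials -/

/-! In both systems $L_r$ agrees on the closed orthant with a polynomial $f$, and $M_r(m)$ is the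
expectation of $f$ under independent Gamma variables of shapes $\alpha_i+m_i$ and scale $1-p$. Such
an expectation is the linear functional `gammaFun`, $X^\kappa\mapsto\prod_i
t^{\kappa_i}(\beta_i)_{\kappa_i}$, which makes sense for all real $\beta$ and $t$.

The key fact is a duality: for these particular $f$, $M_r(m)$ is also $p^{|r|}$ times the same
functional with shapes $-m_i$ and scale $-(1-p)/p$, that is, a combination of falling factorials of
the $m_i$. It comes from Kummer's transformation of ${}_1F_1$ (`kummer`), through `meixner_duality`
for the Laguerre factors and `gammaFun_jacobiPoly_duality` for the Jacobi part.

The rest is summation, done in `bernstein_expansion`. Factorial moments of Poisson variables are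
powers of the mean, so the Poisson($\lambda$) average of $M_r$ is $p^{|r|}L_r(\lambda(1-p)/p)$
(`hasSum_poisson_gammaFun`); this average is the Bernstein series up to a constant. For the
constant, one factor of $M_r^2$ is written in each form: the Negative Binomial pairing of the two
forms is the Gamma pairing (`hasSum_negBinPi_gammaFun`), whence $\rho_r^{-1}=p^{|r|}c_r$.
Orthogonality is never needed. -/

theorem rising_zero (a : ℝ) : rising a 0 = 1 := by simp [rising]

theorem rising_succ (a : ℝ) (n : ℕ) : rising a (n + 1) = rising a n * (a + n) := by
  simp [rising, ascPochhammer_succ_eval]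

theorem rising_add (a : ℝ) (m n : ℕ) :
    rising a (m + n) = rising a m * rising (a + m) n := by
  induction n with
  | zero => simp [rising_zero]
  | succ n ih => rw [← add_assoc, rising_succ, ih, rising_succ]; push_cast; ring

theorem rising_pos {a : ℝ} (ha : 0 < a) (n : ℕ) : 0 < rising a n :=
  ascPochhammer_pos n a ha

theorem rising_neg_natCast (m n : ℕ) :
    (-1 : ℝ) ^ n * rising (-(m : ℝ)) n = m.descFactorial n := by
  rw [rising, ascPochhammer_eval_neg_eq_descPochhammer, descPochhammer_eval_eq_descFactorial,
    ← mul_assoc, ← mul_pow]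
  simp

theorem rising_reflect (x : ℝ) (n : ℕ) :
    rising (1 - x - n) n = (-1) ^ n * rising x n := by
  induction n generalizing x with
  | zero => simp [rising_zero]
  | succ n ih =>
    have h := ih (x + 1)
    rw [rising_succ, show 1 - x - ((n + 1 : ℕ) : ℝ) = 1 - (x + 1) - n by push_cast; ring, h,
      add_comm n 1, rising_add x 1 n, rising_succ, rising_zero]
    push_cast
    ring

theorem Gamma_add_nat {a : ℝ} (ha : 0 < a) (n : ℕ) :
    Real.Gamma (a + n) = rising a n * Real.Gamma a := by
  induction n with
  | zero => simp [rising_zero]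
  | succ n ih =>
    have : a + ((n + 1 : ℕ) : ℝ) = (a + n) + 1 := by push_cast; ring
    rw [this, Real.Gamma_add_one (by positivity), ih, rising_succ]
    ring

/-- The Chu–Vandermonde identity for rising factorials. -/
theorem rising_vandermonde (x y : ℝ) (n : ℕ) :
    rising (x + y) n =
      ∑ ij ∈ Finset.HasAntidiagonal.antidiagonal n, (n.choose ij.1 : ℝ) * (rising x ij.1 * rising y ij.2) := by
  induction n with
  | zero => simp [rising_zero]
  | succ n ih =>
    rw [Finset.sum_antidiagonal_choose_succ_mul (fun i j => rising x i * rising y j) n,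
      rising_succ, ih, Finset.sum_mul, ← Finset.sum_add_distrib]
    refine Finset.sum_congr rfl fun ij hij => ?_
    have h : ij.1 + ij.2 = n := by simpa using hij
    have hc : n.choose ij.2 = n.choose ij.1 := by
      rw [← h, Nat.choose_symm_add]
    rw [hc, rising_succ, rising_succ, ← h]
    push_cast
    ring

/-- Reflection turns $(a+s)_n$ into $(-1)^n(-s+(1-a-n))_n$; Chu–Vandermonde splits it, and a second
reflection restores positive parameters. This is Kummer's transformation read coefficient by
coefficient. -/
theorem rising_add_eq_sum (a s : ℝ) (n : ℕ) :
    rising (a + s) n = ∑ ij ∈ Finset.HasAntidiagonal.antidiagonal n,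
      (n.choose ij.1 : ℝ) * ((-1) ^ ij.1 * rising (-s) ij.1 * rising (a + ij.1) ij.2) := by
  have h := rising_reflect (a + s) n
  have h2 : rising (a + s) n = (-1) ^ n * rising (1 - (a + s) - n) n := by
    rw [h, ← mul_assoc, ← mul_pow]; simp
  rw [h2, show 1 - (a + s) - (n : ℝ) = -s + (1 - a - n) by ring, rising_vandermonde,
    Finset.mul_sum]
  refine Finset.sum_congr rfl fun ij hij => ?_
  have hn : ij.1 + ij.2 = n := by simpa using hij
  have := rising_reflect (a + ij.1) ij.2
  rw [show 1 - (a + (ij.1 : ℝ)) - ij.2 = 1 - a - n by rw [← hn]; push_cast; ring] at this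
  rw [this, ← hn, pow_add]
  have e : (-1 : ℝ) ^ ij.2 * (-1) ^ ij.2 = 1 := by rw [← mul_pow]; simp
  linear_combination ((-1 : ℝ) ^ ij.1 * ((ij.1 + ij.2).choose ij.1 : ℝ) * rising (-s) ij.1 *
    rising (a + ij.1) ij.2) * e

theorem rising_neg_div (n i : ℕ) :
    rising (-(n : ℝ)) i / (i.factorial : ℝ) = (-1) ^ i * (n.choose i : ℝ) := by
  have h1 := rising_neg_natCast n i
  have h2 : rising (-(n : ℝ)) i = (-1) ^ i * n.descFactorial i := by
    rw [← h1, ← mul_assoc, ← mul_pow]; simp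
  rw [h2, Nat.descFactorial_eq_factorial_mul_choose]
  have := Nat.cast_ne_zero (R := ℝ).2 i.factorial_ne_zero
  push_cast
  field_simp

open PowerSeries in
/-- Kummer's transformation of `₁F₁`, as an identity of formal power series. -/
theorem kummer {a : ℝ} (ha : 0 < a) (s : ℝ) :
    (PowerSeries.mk fun n => rising (a + s) n / (rising a n * (n.factorial : ℝ))) =
      PowerSeries.exp ℝ *
        PowerSeries.mk fun n => (-1) ^ n * rising (-s) n / (rising a n * (n.factorial : ℝ)) := by
  ext n
  rw [coeff_mk, mul_comm (PowerSeries.exp ℝ), coeff_mul, rising_add_eq_sum, Finset.sum_div]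
  refine Finset.sum_congr rfl fun ij hij => ?_
  have h : ij.1 + ij.2 = n := by simpa using hij
  have h1 := (rising_pos ha ij.1).ne'
  have h2 := (rising_pos (show 0 < a + ij.1 by positivity) ij.2).ne'
  rw [coeff_mk, coeff_exp, ← h, rising_add, Nat.cast_add_choose]
  have := Nat.cast_ne_zero (R := ℝ).2 (ij.1 + ij.2).factorial_ne_zero
  simp only [map_div₀, map_one, map_natCast]
  field_simp

/-! ### Laguerre and Meixner coefficients -/

/-- The coefficient of `y ^ i` in the Laguerre polynomial. -/
noncomputable def laguerreCoeff (n : ℕ) (a : ℝ) (i : ℕ) : ℝ :=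
  rising a n / (n.factorial : ℝ) * (rising (-(n : ℝ)) i / (rising a i * (i.factorial : ℝ)))

theorem laguerre_eq_sum (n : ℕ) (a y : ℝ) :
    laguerre n a y = ∑ i ∈ Finset.range (n + 1), laguerreCoeff n a i * y ^ i := by
  rw [laguerre, Finset.mul_sum]
  exact Finset.sum_congr rfl fun i _ => by rw [laguerreCoeff]; ring

theorem laguerre_zero_pos (n : ℕ) {a : ℝ} (ha : 0 < a) : 0 < laguerre n a 0 := by
  rw [laguerre_eq_sum, Finset.sum_range_succ']
  simp only [laguerreCoeff, rising_zero]
  have := rising_pos ha n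
  simp
  positivity

open PowerSeries in
/-- The Pfaff-type transformation giving two expressions of the Meixner polynomials. -/
theorem meixner_duality (n : ℕ) {a p : ℝ} (ha : 0 < a) (hp : 0 < p) (t : ℝ) :
    ∑ i ∈ Finset.range (n + 1), laguerreCoeff n a i * (1 - p) ^ i * rising (a + t) i =
      p ^ n * ∑ i ∈ Finset.range (n + 1),
        laguerreCoeff n a i * (-((1 - p) / p)) ^ i * rising (-t) i := by
  set K : PowerSeries ℝ := PowerSeries.mk fun n =>
    rising (a + t) n / (rising a n * (n.factorial : ℝ)) with hK
  set C : PowerSeries ℝ := PowerSeries.mk fun n =>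
    (-1) ^ n * rising (-t) n / (rising a n * (n.factorial : ℝ)) with hC
  -- The $i$-th Laguerre coefficient is $(a)_n(-1)^i/((a)_i\,i!\,(n-i)!)$, so the sum is a Cauchy
  -- product with the exponential series.
  have key : ∀ (q : ℝ) (f : ℕ → ℝ) (F : PowerSeries ℝ),
      F = (PowerSeries.mk fun n => f n / (rising a n * (n.factorial : ℝ))) →
      ∑ i ∈ Finset.range (n + 1), laguerreCoeff n a i * q ^ i * f i =
        rising a n * coeff n (rescale (-q) F * PowerSeries.exp ℝ) := by
    intro q f F hF
    rw [coeff_mul, Finset.Nat.sum_antidiagonal_eq_sum_range_succ_mk, Finset.mul_sum]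
    refine Finset.sum_congr rfl fun i hi => ?_
    have hi' : i ≤ n := by simpa [Nat.lt_succ_iff] using hi
    have h1 := rising_neg_div n i
    have h3 := Nat.cast_ne_zero (R := ℝ).2 i.factorial_ne_zero
    have h4 := Nat.cast_ne_zero (R := ℝ).2 n.factorial_ne_zero
    have h5 := Nat.cast_ne_zero (R := ℝ).2 (n - i).factorial_ne_zero
    have h6 := (rising_pos ha i).ne'
    have h2 : rising (-(n : ℝ)) i = (-1) ^ i * (n.choose i : ℝ) * i.factorial := by
      rw [← h1]; field_simp
    simp only [hF, laguerreCoeff, coeff_rescale, coeff_mk, coeff_exp, h2, neg_pow q,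
      Nat.cast_choose ℝ hi', map_div₀, map_one, map_natCast]
    field_simp
  rw [key (1 - p) _ K rfl]
  have h3 : ∑ i ∈ Finset.range (n + 1),
        laguerreCoeff n a i * (-((1 - p) / p)) ^ i * rising (-t) i =
      rising a n * coeff n (rescale (-((1 - p) / p)) C * PowerSeries.exp ℝ) := by
    have h2 := key ((1 - p) / p) (fun i => (-1) ^ i * rising (-t) i) C rfl
    rw [← h2]
    refine Finset.sum_congr rfl fun i _ => ?_
    rw [neg_pow]; ring
  -- Kummer contributes $e^{-(1-p)x}$, and $e^{-(1-p)x}e^x=e^{px}$: everything is now a series in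
  -- $px$, which yields the factor $p^n$.
  have h4 : rescale (-(1 - p)) K * PowerSeries.exp ℝ =
      rescale p (rescale (-((1 - p) / p)) C * PowerSeries.exp ℝ) := by
    have e1 : rescale (-(1 - p)) (PowerSeries.exp ℝ) * PowerSeries.exp ℝ =
        rescale p (PowerSeries.exp ℝ) := by
      have := PowerSeries.exp_mul_exp_eq_exp_add (A := ℝ) (-(1 - p)) 1
      simpa using this
    rw [hK, kummer ha, map_mul, map_mul, mul_right_comm, e1, rescale_rescale, mul_comm,
      ← hC]
    congr 3
    field_simp
  rw [h3, h4, coeff_rescale]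
  ring

/-! ### Jacobi polynomials in homogeneous form -/

/-- The coefficient of `u ^ i * v ^ j` in the homogeneous Jacobi polynomial. -/
noncomputable def jacobiCoeff (a b : ℝ) (i j : ℕ) : ℝ :=
  (-1) ^ j * rising a (i + j) * ((i + j).factorial : ℝ) /
    (rising a i * (i.factorial : ℝ) * (rising b j * (j.factorial : ℝ)))

/-- The bivariate homogeneous Jacobi polynomial `(u + v) ^ n * R_n^{a,b} (u / (u + v))`. -/
noncomputable def jacobiHom {A : Type*} [CommRing A] [Algebra ℝ A] (n : ℕ) (a b : ℝ) (u v : A) :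
    A :=
  ∑ ij ∈ Finset.HasAntidiagonal.antidiagonal n, jacobiCoeff a b ij.1 ij.2 • (u ^ ij.1 * v ^ ij.2)

open PowerSeries in
-- Each sum is, up to a common factor and sign, the $x^n$ coefficient of a product of two confluent
-- series, one in $x$ and one in $-x$. Kummer's transformation extracts $e^x$ from the first and
-- $e^{-x}$ from the second, and these cancel.
theorem jacobiCoeff_duality (n : ℕ) {a b : ℝ} (ha : 0 < a) (hb : 0 < b) (s t : ℝ) :
    ∑ ij ∈ Finset.HasAntidiagonal.antidiagonal n,
        jacobiCoeff a b ij.1 ij.2 * (rising (a + s) ij.1 * rising (b + t) ij.2) =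
      (-1) ^ n * ∑ ij ∈ Finset.HasAntidiagonal.antidiagonal n,
        jacobiCoeff a b ij.1 ij.2 * (rising (-s) ij.1 * rising (-t) ij.2) := by
  have hs := kummer ha s
  have ht := kummer hb t
  set C1 : PowerSeries ℝ := PowerSeries.mk fun n =>
    (-1) ^ n * rising (-s) n / (rising a n * (n.factorial : ℝ)) with hC1
  set C2 : PowerSeries ℝ := PowerSeries.mk fun n =>
    (-1) ^ n * rising (-t) n / (rising b n * (n.factorial : ℝ)) with hC2
  set K1 : PowerSeries ℝ := PowerSeries.mk fun n =>
    rising (a + s) n / (rising a n * (n.factorial : ℝ)) with hK1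
  set K2 : PowerSeries ℝ := PowerSeries.mk fun n =>
    rising (b + t) n / (rising b n * (n.factorial : ℝ)) with hK2
  have h : K1 * rescale (-1) K2 = C1 * rescale (-1) C2 := by
    have e : PowerSeries.exp ℝ * rescale (-1) (PowerSeries.exp ℝ) = 1 :=
      PowerSeries.exp_mul_exp_neg_eq_one
    rw [hs, ht, map_mul]
    linear_combination C1 * rescale (-1) C2 * e
  have h' := congrArg (fun F => rising a n * (n.factorial : ℝ) * coeff n F) h
  simp only [coeff_mul, Finset.mul_sum] at h'
  rw [Finset.mul_sum]
  convert h' using 1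
  · refine Finset.sum_congr rfl fun ij hij => ?_
    have hn : ij.1 + ij.2 = n := by simpa using hij
    rw [coeff_rescale, coeff_mk, coeff_mk, jacobiCoeff, hn]
    have h1 := (rising_pos ha ij.1).ne'
    have h2 := (rising_pos hb ij.2).ne'
    field_simp
  · refine Finset.sum_congr rfl fun ij hij => ?_
    have hn : ij.1 + ij.2 = n := by simpa using hij
    rw [coeff_rescale, coeff_mk, coeff_mk, jacobiCoeff, hn]
    have h1 := (rising_pos ha ij.1).ne'
    have h2 := (rising_pos hb ij.2).ne'
    have h3 : (-1 : ℝ) ^ n = (-1) ^ ij.1 * (-1) ^ ij.2 := by rw [← pow_add, hn]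
    rw [h3]
    field_simp

/-- Expand $(u+v)^{n-i}$ binomially and collect powers of $v$: each coefficient is a terminating sum
that Chu–Vandermonde evaluates. -/
theorem sum_shifted_eq_jacobiHom (n : ℕ) {a b : ℝ} (ha : 0 < a) (hb : 0 < b) (u v : ℝ) :
    ∑ i ∈ Finset.range (n + 1), rising (-(n : ℝ)) i * rising (n + a + b - 1) i /
        (rising b i * (i.factorial : ℝ)) * (v ^ i * (u + v) ^ (n - i)) =
      jacobiHom n a b u v := by
  have key : ∀ i j : ℕ, jacobiCoeff a b i j = ((i + j).choose j : ℝ) *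
      ∑ q ∈ Finset.HasAntidiagonal.antidiagonal j, (j.choose q.1 : ℝ) * ((-1) ^ q.1 *
        rising ((i + j : ℕ) + a + b - 1) q.1 / rising b q.1) := by
    intro i j
    -- The shift is chosen so that the left side becomes $(1-(a+i)-j)_j$, which reflects to
    -- $(-1)^j(a+i)_j$.
    have h := rising_add_eq_sum b (-(((i + j : ℕ) : ℝ) + a + b - 1)) j
    have h2 := rising_reflect (a + i) j
    rw [show b + -(((i + j : ℕ) : ℝ) + a + b - 1) = 1 - (a + i) - j by push_cast; ring, h2,
      neg_neg] at h
    have hb' := (rising_pos hb j).ne'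
    have h3 : ∑ q ∈ Finset.HasAntidiagonal.antidiagonal j, (j.choose q.1 : ℝ) * ((-1) ^ q.1 *
        rising ((i + j : ℕ) + a + b - 1) q.1 / rising b q.1) =
        (-1) ^ j * rising (a + i) j / rising b j := by
      rw [h, Finset.sum_div]
      refine Finset.sum_congr rfl fun q hq => ?_
      have hj : q.1 + q.2 = j := by simpa using hq
      rw [← hj, rising_add]
      have h1 := (rising_pos hb q.1).ne'
      have h2 := (rising_pos (show 0 < b + q.1 by positivity) q.2).ne'
      field_simp
    rw [h3, jacobiCoeff, rising_add, Nat.choose_symm_add.symm, Nat.cast_add_choose]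
    have h1 := (rising_pos ha i).ne'
    field_simp
  have hl : jacobiHom n a b u v = ∑ ij ∈ Finset.HasAntidiagonal.antidiagonal n,
      ∑ q ∈ Finset.HasAntidiagonal.antidiagonal ij.2, ((n.choose ij.2 : ℝ) * (ij.2.choose q.1 : ℝ) * ((-1) ^ q.1 *
        rising (n + a + b - 1) q.1 / rising b q.1)) * (u ^ ij.1 * v ^ (q.1 + q.2)) := by
    refine Finset.sum_congr rfl fun ij hij => ?_
    have hn : ij.1 + ij.2 = n := by simpa using hij
    rw [key, hn, smul_eq_mul, Finset.mul_sum, Finset.sum_mul]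
    refine Finset.sum_congr rfl fun q hq => ?_
    have hj : q.1 + q.2 = ij.2 := by simpa using hq
    rw [hj]; ring
  have hr : ∑ i ∈ Finset.range (n + 1), rising (-(n : ℝ)) i * rising (n + a + b - 1) i /
        (rising b i * (i.factorial : ℝ)) * (v ^ i * (u + v) ^ (n - i)) =
      ∑ q ∈ Finset.HasAntidiagonal.antidiagonal n, ∑ ij ∈ Finset.HasAntidiagonal.antidiagonal q.2,
        ((n.choose q.1 : ℝ) * (q.2.choose ij.1 : ℝ) * ((-1) ^ q.1 *
        rising (n + a + b - 1) q.1 / rising b q.1)) * (u ^ ij.1 * v ^ (q.1 + ij.2)) := by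
    rw [Finset.Nat.sum_antidiagonal_eq_sum_range_succ_mk]
    refine Finset.sum_congr rfl fun i hi => ?_
    have hi' : i ≤ n := by simpa [Nat.lt_succ_iff] using hi
    have h1 := rising_neg_div n i
    have h3 := Nat.cast_ne_zero (R := ℝ).2 i.factorial_ne_zero
    have h2 : rising (-(n : ℝ)) i = (-1) ^ i * (n.choose i : ℝ) * i.factorial := by
      rw [← h1]; field_simp
    have h6 := (rising_pos hb i).ne'
    rw [(Commute.all u v).add_pow', Finset.mul_sum, Finset.mul_sum]
    refine Finset.sum_congr rfl fun q hq => ?_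
    rw [h2, nsmul_eq_mul, pow_add]
    field_simp
  rw [hl, hr, Finset.sum_sigma', Finset.sum_sigma']
  -- Both sides run over triples $i+q+r=n$, grouped as $i\mid(q,r)$ or as $q\mid(i,r)$; swapping $i$
  -- and $q$ is its own inverse.
  refine Finset.sum_bij' (fun x _ => ⟨(x.2.1, x.1.1 + x.2.2), (x.1.1, x.2.2)⟩)
    (fun x _ => ⟨(x.2.1, x.1.1 + x.2.2), (x.1.1, x.2.2)⟩) ?_ ?_ ?_ ?_ ?_
  · rintro ⟨⟨i, j⟩, ⟨q, r⟩⟩ h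
    simp at h ⊢; omega
  · rintro ⟨⟨i, j⟩, ⟨q, r⟩⟩ h
    simp at h ⊢; omega
  · rintro ⟨⟨i, j⟩, ⟨q, r⟩⟩ h
    simp at h ⊢; omega
  · rintro ⟨⟨i, j⟩, ⟨q, r⟩⟩ h
    simp at h ⊢; omega
  · rintro ⟨⟨i, j⟩, ⟨q, r⟩⟩ h
    simp only [Finset.mem_sigma, Finset.HasAntidiagonal.mem_antidiagonal] at h
    obtain ⟨h1, h2⟩ := h
    subst h1
    subst h2
    have e : ((i + (q + r)).choose i : ℝ) * ((q + r).choose q : ℝ) =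
        ((i + (q + r)).choose (i + r) : ℝ) * ((i + r).choose i : ℝ) := by
      rw [Nat.cast_add_choose, Nat.cast_add_choose, Nat.cast_add_choose,
        show i + (q + r) = i + r + q by ring, Nat.cast_add_choose]
      have := fun n : ℕ => Nat.cast_ne_zero (R := ℝ).2 n.factorial_ne_zero
      field_simp [this]
    simp only
    rw [e]

theorem jacobiR_eq_sum (n : ℕ) {a b : ℝ} (hb : 0 < b) (x : ℝ) :
    jacobiR n a b x = ∑ i ∈ Finset.range (n + 1), rising (-(n : ℝ)) i *
      rising (n + a + b - 1) i / (rising b i * (i.factorial : ℝ)) * (1 - x) ^ i := by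
  have h1 : jacobi n (b - 1) (a - 1) 1 = rising b n / (n.factorial : ℝ) := by
    rw [jacobi, Finset.sum_range_succ']
    simp [rising_zero]
  have h2 : rising b n / (n.factorial : ℝ) ≠ 0 := by
    have := rising_pos hb n
    positivity
  rw [jacobiR, h1, jacobi, sub_add_cancel, mul_div_cancel_left₀ _ h2]
  refine Finset.sum_congr rfl fun i _ => ?_
  rw [show (n : ℝ) + (b - 1) + (a - 1) + 1 = n + a + b - 1 by ring,
    show (1 - (2 * x - 1)) / 2 = 1 - x by ring]

/-- The identity also holds at `u = v = 0`, where `u / (u + v)` is a junk value. -/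
theorem jacobiR_mul_pow (n : ℕ) {a b : ℝ} (ha : 0 < a) (hb : 0 < b) {u v : ℝ} (hu : 0 ≤ u)
    (hv : 0 ≤ v) : jacobiR n a b (u / (u + v)) * (u + v) ^ n = jacobiHom n a b u v := by
  rw [jacobiR_eq_sum n hb, ← sum_shifted_eq_jacobiHom n ha hb, Finset.sum_mul]
  rcases (add_nonneg hu hv).eq_or_lt with h | h
  · have hu0 : u = 0 := by linarith
    have hv0 : v = 0 := by linarith
    subst hu0 hv0
    refine Finset.sum_congr rfl fun i hi => ?_
    have hi' : i ≤ n := by simpa [Nat.lt_succ_iff] using hi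
    rcases Nat.eq_zero_or_pos n with rfl | hn
    · obtain rfl : i = 0 := by omega
      simp
    · rcases Nat.eq_zero_or_pos i with rfl | hi0
      · simp [hn.ne']
      · simp [hn.ne', hi0.ne']
  · refine Finset.sum_congr rfl fun i hi => ?_
    have hi' : i ≤ n := by simpa [Nat.lt_succ_iff] using hi
    have e : 1 - u / (u + v) = v / (u + v) := by field_simp; ring
    have e2 : (u + v) ^ n = (u + v) ^ i * (u + v) ^ (n - i) := by
      rw [← pow_add]; congr 1; omega
    rw [e, e2, div_pow]
    field_simp

theorem jacobiHom_zero_left_ne_zero (n : ℕ) {a b : ℝ} (ha : 0 < a) (hb : 0 < b) :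
    jacobiHom n a b (0 : ℝ) 1 ≠ 0 := by
  rw [jacobiHom, Finset.sum_eq_single (0, n)]
  · have h1 := (rising_pos ha n).ne'
    have h2 := (rising_pos hb n).ne'
    have h3 := Nat.cast_ne_zero (R := ℝ).2 n.factorial_ne_zero
    simp only [jacobiCoeff, pow_zero, one_pow, mul_one, smul_eq_mul, zero_add, rising_zero,
      Nat.factorial_zero, Nat.cast_one, one_mul]
    positivity
  · rintro ⟨i, j⟩ h hne
    have hij : i + j = n := by simpa using h
    have : i ≠ 0 := by rintro rfl; exact hne (by simp at hij; simp [hij])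
    simp [this]
  · simp

/-! ### Gamma moments as a linear functional on polynomials -/

section GammaFun

open MvPolynomial

/-- The linear functional sending the monomial `X ^ κ` to `∏ i, t ^ κ i * (β i)_(κ i)`. For
positive `β` and `t` it is the expectation of independent Gamma variables with shapes `β i` and
scale `t`. -/
noncomputable def gammaFun {σ : Type*} [Fintype σ] (β : σ → ℝ) (t : ℝ) : MvPolynomial σ ℝ →ₗ[ℝ] ℝ :=
  (MvPolynomial.basisMonomials σ ℝ).constr ℝ fun κ => ∏ i, t ^ κ i * rising (β i) (κ i)

theorem gammaFun_monomial {σ : Type*} [Fintype σ] (β : σ → ℝ) (t : ℝ) (κ : σ →₀ ℕ) (a : ℝ) :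
    gammaFun β t (monomial κ a) = a * ∏ i, t ^ κ i * rising (β i) (κ i) := by
  have h : monomial κ a = a • (MvPolynomial.basisMonomials σ ℝ κ) := by
    rw [coe_basisMonomials, smul_monomial, smul_eq_mul, mul_one]
  rw [h, map_smul, gammaFun, Module.Basis.constr_basis, smul_eq_mul]

theorem gammaFun_X_mul_monomial {σ : Type*} [Fintype σ] [DecidableEq σ] (β : σ → ℝ) (t : ℝ) (i : σ) (κ : σ →₀ ℕ) (a : ℝ) :
    gammaFun β t (X i * monomial κ a) = t * (β i + κ i) * gammaFun β t (monomial κ a) := by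
  rw [X, monomial_mul, gammaFun_monomial, gammaFun_monomial, one_mul,
    ← Finset.mul_prod_erase Finset.univ _ (Finset.mem_univ i),
    ← Finset.mul_prod_erase Finset.univ (fun i => t ^ κ i * rising (β i) (κ i))
      (Finset.mem_univ i)]
  have h : ∏ j ∈ Finset.univ.erase i, t ^ (Finsupp.single i 1 + κ : σ →₀ ℕ) j *
      rising (β j) ((Finsupp.single i 1 + κ : σ →₀ ℕ) j) =
      ∏ j ∈ Finset.univ.erase i, t ^ κ j * rising (β j) (κ j) := by
    refine Finset.prod_congr rfl fun j hj => ?_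
    simp [Finsupp.single_eq_of_ne (Finset.ne_of_mem_erase hj)]
  rw [h]
  simp only [Finsupp.add_apply, Finsupp.single_eq_same, add_comm 1 (κ i), rising_succ, pow_succ]
  ring

/-- The weight that counts the degree in the variables of `S`. -/
def degOn {σ : Type*} [DecidableEq σ] (S : Finset σ) : σ → ℕ := fun i => if i ∈ S then 1 else 0

theorem weight_degOn {σ : Type*} [Fintype σ] [DecidableEq σ] (S : Finset σ) (κ : σ →₀ ℕ) :
    Finsupp.weight (degOn S) κ = ∑ i ∈ S, κ i := by
  rw [Finsupp.weight_apply, Finsupp.sum_fintype _ _ (by simp)]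
  simp [degOn]

/-- On a monomial, $X_i$ acts as $t(\beta_i+\kappa_i)$. Summed over $S$ this depends on $\kappa$
only through its degree in $S$, which homogeneity makes constant on $f$. -/
theorem gammaFun_sum_X_mul {σ : Type*} [Fintype σ] [DecidableEq σ] (β : σ → ℝ) (t : ℝ) (S : Finset σ) {f : MvPolynomial σ ℝ} {N : ℕ}
    (hf : IsWeightedHomogeneous (degOn S) f N) :
    gammaFun β t ((∑ i ∈ S, X i) * f) = t * (∑ i ∈ S, β i + N) * gammaFun β t f := by
  conv_lhs => rw [← support_sum_monomial_coeff f]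
  conv_rhs => rw [← support_sum_monomial_coeff f]
  rw [Finset.mul_sum, map_sum, map_sum, Finset.mul_sum]
  refine Finset.sum_congr rfl fun κ hκ => ?_
  rw [Finset.sum_mul, map_sum]
  simp_rw [gammaFun_X_mul_monomial]
  rw [← Finset.sum_mul, ← Finset.mul_sum, Finset.sum_add_distrib]
  have h := hf (mem_support_iff.1 hκ)
  rw [weight_degOn] at h
  rw [← h]
  push_cast
  rfl

theorem isWeightedHomogeneous_sum_X {σ : Type*} [DecidableEq σ] {S T : Finset σ} (h : T ⊆ S) :
    IsWeightedHomogeneous (degOn S) (∑ i ∈ T, (X i : MvPolynomial σ ℝ)) 1 := by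
  refine IsWeightedHomogeneous.sum _ _ _ fun i hi => ?_
  have := isWeightedHomogeneous_X ℝ (degOn S) i
  rwa [degOn, if_pos (h hi)] at this

theorem isWeightedHomogeneous_sum_X_disjoint {σ : Type*} [DecidableEq σ] {S T : Finset σ} (h : Disjoint T S) :
    IsWeightedHomogeneous (degOn S) (∑ i ∈ T, (X i : MvPolynomial σ ℝ)) 0 := by
  refine IsWeightedHomogeneous.sum _ _ _ fun i hi => ?_
  have := isWeightedHomogeneous_X ℝ (degOn S) i
  rwa [degOn, if_neg (Finset.disjoint_left.1 h hi)] at this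

theorem gammaFun_sum_X_pow_mul {σ : Type*} [Fintype σ] [DecidableEq σ] (β : σ → ℝ) (t : ℝ) (S : Finset σ) {f : MvPolynomial σ ℝ} {N : ℕ}
    (hf : IsWeightedHomogeneous (degOn S) f N) (q : ℕ) :
    gammaFun β t ((∑ i ∈ S, X i) ^ q * f) =
      t ^ q * rising (∑ i ∈ S, β i + N) q * gammaFun β t f := by
  induction q with
  | zero => simp [rising_zero]
  | succ q ih =>
    have h : IsWeightedHomogeneous (degOn S) ((∑ i ∈ S, X i) ^ q * f) (q + N) := by
      have := ((isWeightedHomogeneous_sum_X (le_refl S)).pow q).mul hf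
      simpa using this
    rw [pow_succ', mul_assoc, gammaFun_sum_X_mul β t S h, ih, rising_succ]
    push_cast
    ring

theorem gammaFun_scale {σ : Type*} [Fintype σ] [DecidableEq σ] (β : σ → ℝ) (t : ℝ) {f : MvPolynomial σ ℝ} {N : ℕ}
    (hf : IsWeightedHomogeneous (degOn Finset.univ) f N) :
    gammaFun β t f = t ^ N * gammaFun β 1 f := by
  conv_lhs => rw [← support_sum_monomial_coeff f]
  conv_rhs => rw [← support_sum_monomial_coeff f]
  rw [map_sum, map_sum, Finset.mul_sum]
  refine Finset.sum_congr rfl fun κ hκ => ?_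
  have h := hf (mem_support_iff.1 hκ)
  rw [weight_degOn] at h
  rw [gammaFun_monomial, gammaFun_monomial, ← h, ← Finset.prod_pow_eq_pow_sum,
    Finset.prod_mul_distrib]
  simp only [one_pow, one_mul]
  ring

theorem eval_scale {σ : Type*} [Fintype σ] [DecidableEq σ] (t : ℝ) (y : σ → ℝ) {f : MvPolynomial σ ℝ} {N : ℕ}
    (hf : IsWeightedHomogeneous (degOn Finset.univ) f N) :
    eval (fun i => t * y i) f = t ^ N * eval y f := by
  conv_lhs => rw [← support_sum_monomial_coeff f]
  conv_rhs => rw [← support_sum_monomial_coeff f]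
  rw [map_sum, map_sum, Finset.mul_sum]
  refine Finset.sum_congr rfl fun κ hκ => ?_
  have h := hf (mem_support_iff.1 hκ)
  rw [weight_degOn] at h
  rw [eval_monomial, eval_monomial, Finsupp.prod_fintype _ _ (by simp),
    Finsupp.prod_fintype _ _ (by simp), ← h, ← Finset.prod_pow_eq_pow_sum]
  simp only [mul_pow, Finset.prod_mul_distrib]
  ring

theorem isWeightedHomogeneous_jacobiHom {σ : Type*} {w : σ → ℕ} {u v : MvPolynomial σ ℝ} {d : ℕ}
    (hu : IsWeightedHomogeneous w u d) (hv : IsWeightedHomogeneous w v d) (n : ℕ) (a b : ℝ) :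
    IsWeightedHomogeneous w (jacobiHom n a b u v) (n * d) := by
  refine IsWeightedHomogeneous.sum _ _ _ fun ij hij => ?_
  have hn : ij.1 + ij.2 = n := by simpa using hij
  have h := ((hu.pow ij.1).mul (hv.pow ij.2)).C_mul (jacobiCoeff a b ij.1 ij.2)
  rw [C_mul', smul_eq_mul, smul_eq_mul, ← add_mul, hn] at h
  exact h

end GammaFun

/-! ### The multivariate Jacobi polynomial in homogeneous form -/

section JacobiPoly

open MvPolynomial

variable {k : ℕ}

/-- The product over `j ∈ s` of the homogeneous Jacobi polynomials in `X_j` and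
`∑_{i > j} X_i`. -/
noncomputable def jacobiProd (a b : Fin k → ℝ) (n : Fin k → ℕ) (s : Finset (Fin k)) :
    MvPolynomial (Fin (k + 1)) ℝ :=
  ∏ j ∈ s, jacobiHom (n j) (a j) (b j) (X j.castSucc) (∑ i ∈ Finset.Ioi j.castSucc, X i)

theorem isWeightedHomogeneous_jacobiProd (a b : Fin k → ℝ) (n : Fin k → ℕ) (s : Finset (Fin k))
    (S : Finset (Fin (k + 1))) (h : ∀ j ∈ s, Finset.Ici j.castSucc ⊆ S) :
    IsWeightedHomogeneous (degOn S) (jacobiProd a b n s) (∑ j ∈ s, n j) := by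
  refine IsWeightedHomogeneous.prod _ _ _ fun j hj => ?_
  have h1 : IsWeightedHomogeneous (degOn S) (X j.castSucc : MvPolynomial (Fin (k + 1)) ℝ) 1 := by
    have := isWeightedHomogeneous_sum_X (S := S) (T := {j.castSucc})
      (Finset.singleton_subset_iff.2 (h j hj (by simp)))
    simpa using this
  have h2 := isWeightedHomogeneous_sum_X (S := S) (T := Finset.Ioi j.castSucc)
    (Finset.Ioi_subset_Ici_self.trans (h j hj))
  simpa using isWeightedHomogeneous_jacobiHom h1 h2 (n j) (a j) (b j)

theorem isWeightedHomogeneous_jacobiProd_zero (a b : Fin k → ℝ) (n : Fin k → ℕ)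
    (s : Finset (Fin k)) (S : Finset (Fin (k + 1)))
    (h : ∀ j ∈ s, Disjoint (Finset.Ici j.castSucc) S) :
    IsWeightedHomogeneous (degOn S) (jacobiProd a b n s) 0 := by
  have := IsWeightedHomogeneous.prod (w := degOn S) s
    (fun j => jacobiHom (n j) (a j) (b j) (X j.castSucc : MvPolynomial (Fin (k + 1)) ℝ)
      (∑ i ∈ Finset.Ioi j.castSucc, X i)) (fun _ => 0) fun j hj => ?_
  · simpa [jacobiProd] using this
  have h1 : IsWeightedHomogeneous (degOn S) (X j.castSucc : MvPolynomial (Fin (k + 1)) ℝ) 0 := by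
    have := isWeightedHomogeneous_sum_X_disjoint (S := S) (T := {j.castSucc})
      (Finset.disjoint_of_subset_left (by simp) (h j hj))
    simpa using this
  have h2 := isWeightedHomogeneous_sum_X_disjoint (S := S) (T := Finset.Ioi j.castSucc)
    (Finset.disjoint_of_subset_left Finset.Ioi_subset_Ici_self (h j hj))
  simpa using isWeightedHomogeneous_jacobiHom h1 h2 (n j) (a j) (b j)

/-- Peel off the factor of smallest index $l$. The remaining factors do not contain $X_l$ and are
homogeneous in the variables beyond $l$, whose sum is the second argument of the peeled factor.
Hence `gammaFun_sum_X_pow_mul` applies to both arguments, and the degree of the remaining factors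
shifts the second shape. -/
theorem gammaFun_jacobiProd (a b : Fin k → ℝ) (n : Fin k → ℕ) (β : Fin (k + 1) → ℝ)
    (s : Finset (Fin k)) :
    gammaFun β 1 (jacobiProd a b n s) =
      ∏ j ∈ s, ∑ ij ∈ Finset.HasAntidiagonal.antidiagonal (n j), jacobiCoeff (a j) (b j) ij.1 ij.2 *
        (rising (β j.castSucc) ij.1 * rising (∑ i ∈ Finset.Ioi j.castSucc, β i +
          ((∑ i ∈ s with j < i, n i : ℕ) : ℝ)) ij.2) := by
  induction s using Finset.induction_on_min with
  | empty =>
    have : (jacobiProd a b n ∅) = monomial 0 1 := by simp [jacobiProd]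
    rw [this, gammaFun_monomial]
    simp [rising_zero]
  | insert l s hl ih =>
    have hls : l ∉ s := fun h => lt_irrefl _ (hl l h)
    rw [Finset.prod_insert hls]
    have hs : ∀ j ∈ s, (insert l s).filter (j < ·) = s.filter (j < ·) := by
      intro j hj
      rw [Finset.filter_insert, if_neg (hl j hj).not_gt]
    have hl2 : (insert l s).filter (l < ·) = s := by
      rw [Finset.filter_insert, if_neg (lt_irrefl l), Finset.filter_true_of_mem hl]
    rw [hl2]
    have e : ∏ j ∈ s, ∑ ij ∈ Finset.HasAntidiagonal.antidiagonal (n j),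
        jacobiCoeff (a j) (b j) ij.1 ij.2 *
        (rising (β j.castSucc) ij.1 * rising (∑ i ∈ Finset.Ioi j.castSucc, β i +
          ((∑ i ∈ insert l s with j < i, n i : ℕ) : ℝ)) ij.2) =
        gammaFun β 1 (jacobiProd a b n s) := by
      rw [ih]
      exact Finset.prod_congr rfl fun j hj => by rw [hs j hj]
    rw [e, Finset.sum_mul]
    have e2 : jacobiProd a b n (insert l s) = ∑ ij ∈ Finset.HasAntidiagonal.antidiagonal (n l),
        jacobiCoeff (a l) (b l) ij.1 ij.2 • ((∑ i ∈ {l.castSucc}, X i) ^ ij.1 *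
          ((∑ i ∈ Finset.Ioi l.castSucc, X i) ^ ij.2 * jacobiProd a b n s)) := by
      rw [jacobiProd, Finset.prod_insert hls, jacobiHom, Finset.sum_mul]
      refine Finset.sum_congr rfl fun ij _ => ?_
      rw [smul_mul_assoc, mul_assoc, Finset.sum_singleton, jacobiProd]
    rw [e2, map_sum]
    refine Finset.sum_congr rfl fun ij _ => ?_
    have h1 := isWeightedHomogeneous_jacobiProd a b n s (Finset.Ioi l.castSucc) (by
      intro j hj i hi
      rw [Finset.mem_Ici] at hi
      rw [Finset.mem_Ioi]
      exact lt_of_lt_of_le (Fin.castSucc_lt_castSucc_iff.2 (hl j hj)) hi)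
    have h2 : IsWeightedHomogeneous (degOn {l.castSucc})
        ((∑ i ∈ Finset.Ioi l.castSucc, X i) ^ ij.2 * jacobiProd a b n s) 0 := by
      have h3 := (isWeightedHomogeneous_sum_X_disjoint (S := {l.castSucc})
        (T := Finset.Ioi l.castSucc) (by simp)).pow ij.2
      have h4 := isWeightedHomogeneous_jacobiProd_zero a b n s {l.castSucc} (by
        intro j hj
        rw [Finset.disjoint_singleton_right, Finset.mem_Ici, not_le]
        exact Fin.castSucc_lt_castSucc_iff.2 (hl j hj))
      simpa using h3.mul h4
    rw [map_smul, gammaFun_sum_X_pow_mul β 1 _ h2, gammaFun_sum_X_pow_mul β 1 _ h1]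
    simp
    ring

/-- The second parameter of the `j`-th factor of the multivariate Jacobi polynomial. -/
noncomputable def jacobiParam (α : Fin (k + 1) → ℝ) (n : Fin k → ℕ) (j : Fin k) : ℝ :=
  (∑ i ∈ Finset.Ioi j.castSucc, α i) + 2 * ((∑ i ∈ Finset.Ioi j, n i : ℕ) : ℝ)

theorem jacobiParam_pos {α : Fin (k + 1) → ℝ} (hα : ∀ i, 0 < α i) (n : Fin k → ℕ) (j : Fin k) :
    0 < jacobiParam α n j := by
  have : 0 < ∑ i ∈ Finset.Ioi j.castSucc, α i :=
    Finset.sum_pos (fun i _ => hα i) ⟨Fin.last k, by simp [Fin.castSucc_lt_last]⟩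
  rw [jacobiParam]
  positivity

/-- The homogeneous form of the multivariate Jacobi polynomial. -/
noncomputable def jacobiPoly (α : Fin (k + 1) → ℝ) (n : Fin k → ℕ) :
    MvPolynomial (Fin (k + 1)) ℝ :=
  jacobiProd (fun j => α j.castSucc) (jacobiParam α n) n Finset.univ

theorem isWeightedHomogeneous_jacobiPoly (α : Fin (k + 1) → ℝ) (n : Fin k → ℕ) :
    IsWeightedHomogeneous (degOn Finset.univ) (jacobiPoly α n) (∑ j, n j) :=
  isWeightedHomogeneous_jacobiProd _ _ _ _ _ fun _ _ => Finset.subset_univ _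

/-- Factor by factor this is `jacobiCoeff_duality`. The parameter $A_j+2N_j$ is what makes it fit:
with $t=\sum_{i>j}x_i-N_j$, both $b+t$ and $-t$ carry the same shift $+N_j$ that
`gammaFun_jacobiProd` produces. -/
theorem gammaFun_jacobiPoly_duality {α : Fin (k + 1) → ℝ} (hα : ∀ i, 0 < α i) (n : Fin k → ℕ)
    (x : Fin (k + 1) → ℝ) :
    gammaFun (fun i => α i + x i) 1 (jacobiPoly α n) =
      (-1) ^ (∑ j, n j) * gammaFun (fun i => -x i) 1 (jacobiPoly α n) := by
  rw [jacobiPoly, gammaFun_jacobiProd, gammaFun_jacobiProd, ← Finset.prod_pow_eq_pow_sum,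
    ← Finset.prod_mul_distrib]
  refine Finset.prod_congr rfl fun j _ => ?_
  have hf : Finset.univ.filter (j < ·) = Finset.Ioi j := by ext; simp
  rw [hf]
  have h := jacobiCoeff_duality (n j) (hα j.castSucc) (jacobiParam_pos hα n j) (x j.castSucc)
    (∑ i ∈ Finset.Ioi j.castSucc, x i - ((∑ i ∈ Finset.Ioi j, n i : ℕ) : ℝ))
  rw [show -(∑ i ∈ Finset.Ioi j.castSucc, x i - ((∑ i ∈ Finset.Ioi j, n i : ℕ) : ℝ)) =
    ∑ i ∈ Finset.Ioi j.castSucc, -x i + ((∑ i ∈ Finset.Ioi j, n i : ℕ) : ℝ) by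
      rw [Finset.sum_neg_distrib]; ring,
    show jacobiParam α n j + (∑ i ∈ Finset.Ioi j.castSucc, x i -
      ((∑ i ∈ Finset.Ioi j, n i : ℕ) : ℝ)) = ∑ i ∈ Finset.Ioi j.castSucc, (α i + x i) +
      ((∑ i ∈ Finset.Ioi j, n i : ℕ) : ℝ) by
      rw [Finset.sum_add_distrib, jacobiParam]; ring] at h
  exact h

theorem eval_jacobiPoly (α : Fin (k + 1) → ℝ) (n : Fin k → ℕ) (y : Fin (k + 1) → ℝ) :
    eval y (jacobiPoly α n) = ∏ j : Fin k, jacobiHom (n j) (α j.castSucc) (jacobiParam α n j)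
      (y j.castSucc) (∑ i ∈ Finset.Ioi j.castSucc, y i) := by
  rw [jacobiPoly, jacobiProd, map_prod]
  refine Finset.prod_congr rfl fun j _ => ?_
  simp only [jacobiHom, map_sum, smul_eval, map_mul, map_pow, eval_X, smul_eq_mul]

theorem multiJacobi_eq_eval {α : Fin (k + 1) → ℝ} (hα : ∀ i, 0 < α i) (n : Fin k → ℕ)
    {y : Fin (k + 1) → ℝ} (hy : ∀ i, 0 ≤ y i) (hy1 : ∑ i, y i = 1) :
    multiJacobi α n (fun j => y j.castSucc) = eval y (jacobiPoly α n) := by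
  rw [multiJacobi, eval_jacobiPoly]
  refine Finset.prod_congr rfl fun j _ => ?_
  -- Since the coordinates sum to one, $1-s_{j-1}$ is the tail sum $u+v$ of `jacobiR_mul_pow`.
  have h : 1 - ∑ i ∈ Finset.Iio j, y i.castSucc =
      y j.castSucc + ∑ i ∈ Finset.Ioi j.castSucc, y i := by
    have h1 : ∑ i ∈ Finset.Iio j, y i.castSucc = ∑ i ∈ Finset.Iio j.castSucc, y i := by
      rw [← Fin.map_castSuccEmb_Iio, Finset.sum_map]
      rfl
    have h2 : y j.castSucc + ∑ i ∈ Finset.Ioi j.castSucc, y i =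
        ∑ i ∈ Finset.Ici j.castSucc, y i := by
      rw [← Finset.Ioi_insert, Finset.sum_insert (by simp)]
    have h3 : ∑ i ∈ Finset.Iio j.castSucc, y i + ∑ i ∈ Finset.Ici j.castSucc, y i = ∑ i, y i := by
      have : Finset.Ici j.castSucc = (Finset.Iio j.castSucc)ᶜ := by ext; simp
      rw [this, Finset.sum_add_sum_compl]
    rw [h1, h2]; linarith
  rw [h]
  exact jacobiR_mul_pow (n j) (hα _) (jacobiParam_pos hα n j) (hy _)
    (Finset.sum_nonneg fun i _ => hy i)

end JacobiPoly

/-! ### Series over multi-indices -/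

theorem hasSum_mul_of_nonneg {ι κ : Type*} {u : ι → ℝ} {v : κ → ℝ} {s t : ℝ}
    (hu0 : ∀ i, 0 ≤ u i) (hv0 : ∀ i, 0 ≤ v i) (hu : HasSum u s) (hv : HasSum v t) :
    HasSum (fun x : ι × κ => u x.1 * v x.2) (s * t) :=
  hu.mul hv (hu.summable.mul_of_nonneg hv.summable hu0 hv0)

theorem hasSum_pi_prod {d : ℕ} (f : Fin d → ℕ → ℝ) (a : Fin d → ℝ) (h0 : ∀ i m, 0 ≤ f i m)
    (h : ∀ i, HasSum (f i) (a i)) :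
    HasSum (fun m : Fin d → ℕ => ∏ i, f i (m i)) (∏ i, a i) := by
  induction d with
  | zero => simp
  | succ d ih =>
    have h1 := ih (fun i => f i.succ) (fun i => a i.succ) (fun i => h0 i.succ) (fun i => h i.succ)
    have h2 := hasSum_mul_of_nonneg (h0 0)
      (fun m => Finset.prod_nonneg fun i _ => h0 i.succ (m i)) (h 0) h1
    rw [Fin.prod_univ_succ, ← (Fin.consEquiv fun _ => ℕ).hasSum_iff]
    refine h2.congr_fun fun x => ?_
    simp [Fin.prod_univ_succ, Fin.consEquiv]

/-- The first $n$ terms vanish, so the sum may start at $m=n$. -/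
theorem hasSum_mul_descFactorial {w : ℕ → ℝ} {s : ℝ} (n : ℕ)
    (h : HasSum (fun j => w (j + n) * (((j + n).factorial : ℝ) / j.factorial)) s) :
    HasSum (fun m => w m * (m.descFactorial n : ℝ)) s := by
  have h0 : ∑ i ∈ Finset.range n, w i * (i.descFactorial n : ℝ) = 0 :=
    Finset.sum_eq_zero fun i hi => by
      rw [Nat.descFactorial_of_lt (Finset.mem_range.1 hi)]; simp
  have h1 := (hasSum_nat_add_iff' (f := fun m => w m * (m.descFactorial n : ℝ)) (g := s) n).1
  rw [h0, sub_zero] at h1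
  refine h1 (h.congr_fun fun j => ?_)
  have h2 := Nat.factorial_mul_descFactorial (Nat.le_add_left n j)
  rw [Nat.add_sub_cancel] at h2
  have h3 := Nat.cast_ne_zero (R := ℝ).2 j.factorial_ne_zero
  rw [← h2]
  push_cast
  field_simp

theorem hasSum_poisson_descFactorial (l : ℝ) (n : ℕ) :
    HasSum (fun m : ℕ => Real.exp (-l) * (l ^ m / m.factorial) * (m.descFactorial n : ℝ))
      (l ^ n) := by
  apply hasSum_mul_descFactorial
  have h : HasSum (fun j : ℕ => l ^ j / j.factorial) (Real.exp l) := by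
    rw [Real.exp_eq_exp_ℝ]
    exact NormedSpace.expSeries_div_hasSum_exp l
  have h2 := h.mul_left (Real.exp (-l) * l ^ n)
  rw [mul_right_comm, ← Real.exp_add, neg_add_cancel, Real.exp_zero, one_mul] at h2
  refine h2.congr_fun fun j => ?_
  have h3 := Nat.cast_ne_zero (R := ℝ).2 (j + n).factorial_ne_zero
  field_simp
  ring

theorem hasSum_rising_mul_pow (a : ℝ) {p : ℝ} (hp0 : 0 ≤ p) (hp1 : p < 1) :
    HasSum (fun j : ℕ => rising a j / j.factorial * p ^ j) ((1 - p) ^ (-a)) := by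
  have h := (Real.one_div_one_sub_rpow_hasFPowerSeriesOnBall_zero a).hasSum (y := p) (by
    rw [Metric.mem_eball, edist_zero_right, enorm_eq_nnnorm]
    have : ‖p‖₊ < 1 := by
      rw [← NNReal.coe_lt_coe, coe_nnnorm, Real.norm_of_nonneg hp0]; simpa using hp1
    exact_mod_cast this)
  rw [zero_add, one_div, ← Real.rpow_neg (by linarith)] at h
  refine h.congr_fun fun j => ?_
  rw [FormalMultilinearSeries.ofScalars_apply_eq, smul_eq_mul]
  congr 1
  have h1 := Ring.factorial_nsmul_multichoose_eq_ascPochhammer a j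
  rw [Polynomial.ascPochhammer_smeval_eq_eval, nsmul_eq_mul] at h1
  have h3 := Nat.cast_ne_zero (R := ℝ).2 j.factorial_ne_zero
  rw [Ring.choose, rising, ← h1, show a + j - 1 - j + 1 = a by ring]
  field_simp

/-- After the shift by $j$, $(a)_{m+j}(a+m+j)_i=(a)_{i+j}(a+i+j)_m$, leaving the binomial series of
exponent $-(a+i+j)$. The value depends only on $i+j$, which is why the multivariate pairing sees
only the product of the two polynomials. -/
theorem hasSum_negBin_moment (a : ℝ) {p : ℝ} (hp0 : 0 < p) (hp1 : p < 1) (i j : ℕ) :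
    HasSum (fun m : ℕ => negBin a p m * ((1 - p) ^ i * rising (a + m) i) *
      (((1 - p) / p) ^ j * (m.descFactorial j : ℝ))) (rising a (i + j)) := by
  have h : HasSum (fun m : ℕ => (negBin a p m * ((1 - p) ^ i * rising (a + m) i) *
      (((1 - p) / p) ^ j)) * (m.descFactorial j : ℝ)) (rising a (i + j)) := by
    apply hasSum_mul_descFactorial
    have hq : 0 < 1 - p := by linarith
    have h1 := (hasSum_rising_mul_pow (a + (i + j : ℕ)) hp0.le hp1).mul_left
      (rising a (i + j) * (1 - p) ^ a * (1 - p) ^ (i + j))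
    have e : rising a (i + j) * (1 - p) ^ a * (1 - p) ^ (i + j) *
        (1 - p) ^ (-(a + (i + j : ℕ))) = rising a (i + j) := by
      rw [neg_add, Real.rpow_add hq, Real.rpow_neg hq.le, Real.rpow_neg hq.le, Real.rpow_natCast]
      have := Real.rpow_pos_of_pos hq a
      field_simp
    rw [e] at h1
    refine h1.congr_fun fun m => ?_
    have h3 := Nat.cast_ne_zero (R := ℝ).2 (m + j).factorial_ne_zero
    have h4 := Nat.cast_ne_zero (R := ℝ).2 m.factorial_ne_zero
    have e1 : rising a (m + j) * rising (a + (m + j : ℕ)) i =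
        rising a (i + j) * rising (a + (i + j : ℕ)) m := by
      rw [← rising_add, ← rising_add]; congr 1; ring
    rw [negBin, div_pow, pow_add, pow_add]
    field_simp
    linear_combination e1
  exact h.congr_fun fun m => by ring

open MvPolynomial

/-- The signs of the negative shapes and of the negative scale cancel, so the formal functional
becomes a scaled falling factorial in $m$. -/
theorem gammaFun_neg_monomial {d : ℕ} (m : Fin d → ℕ) (c : ℝ) (κ : Fin d →₀ ℕ) (a : ℝ) :
    gammaFun (fun i => -(m i : ℝ)) (-c) (monomial κ a) =
      a * ∏ i, c ^ κ i * ((m i).descFactorial (κ i) : ℝ) := by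
  rw [gammaFun_monomial]
  congr 1
  refine Finset.prod_congr rfl fun i _ => ?_
  rw [← rising_neg_natCast, neg_pow]
  ring

/-- The Poisson mixture of factorial moments returns the polynomial. -/
theorem hasSum_poisson_gammaFun {d : ℕ} (l : Fin d → ℝ) (hl : ∀ i, 0 ≤ l i) {c : ℝ} (hc : 0 ≤ c)
    (f : MvPolynomial (Fin d) ℝ) :
    HasSum (fun m : Fin d → ℕ => (∏ i, Real.exp (-l i) * (l i ^ m i / (m i).factorial)) *
      gammaFun (fun i => -(m i : ℝ)) (-c) f) (eval (fun i => l i * c) f) := by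
  induction f using MvPolynomial.induction_on' with
  | monomial κ a =>
    have h := (hasSum_pi_prod (fun i m => (Real.exp (-l i) * (l i ^ m / m.factorial) *
      (m.descFactorial (κ i) : ℝ)) * c ^ κ i) (fun i => l i ^ κ i * c ^ κ i)
      (fun i m => by have := hl i; positivity)
      (fun i => (hasSum_poisson_descFactorial (l i) (κ i)).mul_right _)).mul_left a
    rw [eval_monomial, Finsupp.prod_fintype _ _ (by simp)]
    simp only [mul_pow]
    refine h.congr_fun fun m => ?_
    rw [gammaFun_neg_monomial, mul_left_comm, ← Finset.prod_mul_distrib]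
    congr 1
    exact Finset.prod_congr rfl fun i _ => by ring
  | add f g hf hg =>
    simp only [map_add, mul_add]
    exact hf.add hg

/-- The Negative Binomial pairing of the two transforms is the Gamma pairing. -/
theorem hasSum_negBinPi_gammaFun {d : ℕ} {α : Fin d → ℝ} (hα : ∀ i, 0 < α i) {p : ℝ}
    (hp0 : 0 < p) (hp1 : p < 1) (f g : MvPolynomial (Fin d) ℝ) :
    HasSum (fun m : Fin d → ℕ => negBinPi α p m *
      (gammaFun (fun i => α i + m i) (1 - p) f *
        gammaFun (fun i => -(m i : ℝ)) (-((1 - p) / p)) g)) (gammaFun α 1 (f * g)) := by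
  have hq : 0 < 1 - p := by linarith
  induction f using MvPolynomial.induction_on' with
  | monomial κ a =>
    induction g using MvPolynomial.induction_on' with
    | monomial μ b =>
      have h := (hasSum_pi_prod (fun i m => negBin (α i) p m *
        ((1 - p) ^ κ i * rising (α i + m) (κ i)) *
        (((1 - p) / p) ^ μ i * (m.descFactorial (μ i) : ℝ))) (fun i => rising (α i) (κ i + μ i))
        (fun i m => by
          have h1 := (rising_pos (hα i) m).le
          have h2 := (rising_pos (show 0 < α i + m by have := hα i; positivity) (κ i)).le
          rw [negBin]
          positivity)
        (fun i => hasSum_negBin_moment (α i) hp0 hp1 (κ i) (μ i))).mul_left (a * b)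
      rw [monomial_mul, gammaFun_monomial]
      simp only [one_pow, one_mul, Finsupp.add_apply]
      refine h.congr_fun fun m => ?_
      rw [gammaFun_neg_monomial, gammaFun_monomial, negBinPi]
      simp only [Finset.prod_mul_distrib]
      ring
    | add f g hf hg =>
      simp only [map_add, mul_add]
      exact hf.add hg
  | add f g hf hg =>
    simp only [map_add, mul_add, add_mul]
    exact hf.add hg

/-! ### Gamma integrals -/

theorem ae_gammaMeasure_nonneg (a r : ℝ) : ∀ᵐ z ∂gammaMeasure a r, 0 ≤ z := by
  rw [gammaMeasure, ae_withDensity_iff (by unfold gammaPDF; fun_prop)]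
  refine Filter.Eventually.of_forall fun z hz => ?_
  by_contra h
  exact hz (gammaPDF_of_neg (not_le.1 h))

/-- Multiplying the density of shape $a$ by $z^n$ gives a multiple of the density of shape $a+n$,
which has total mass one. -/
theorem lintegral_pow_gammaMeasure {a r : ℝ} (ha : 0 < a) (hr : 0 < r) (n : ℕ) :
    ∫⁻ z, ENNReal.ofReal (z ^ n) ∂gammaMeasure a r = ENNReal.ofReal (rising a n / r ^ n) := by
  have hc : 0 ≤ rising a n / r ^ n := by have := rising_pos ha n; positivity
  have h1 := lintegral_gammaPDF_eq_one (show 0 < a + n by positivity) hr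
  rw [gammaMeasure, lintegral_withDensity_eq_lintegral_mul _ (by unfold gammaPDF; fun_prop)
    (by fun_prop), ← mul_one (ENNReal.ofReal (rising a n / r ^ n)), ← h1,
    ← lintegral_const_mul _ (by unfold gammaPDF; fun_prop)]
  refine lintegral_congr_ae ?_
  have h0 : ∀ᵐ z : ℝ, z ≠ 0 := by simp [ae_iff]
  filter_upwards [h0] with z hz
  rcases lt_or_gt_of_ne hz with h | h
  · simp [gammaPDF_of_neg h]
  · rw [Pi.mul_apply, gammaPDF_of_nonneg h.le, gammaPDF_of_nonneg h.le, ← ENNReal.ofReal_mul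
      (by have := Real.Gamma_pos_of_pos ha; positivity), ← ENNReal.ofReal_mul hc,
      Gamma_add_nat ha, Real.rpow_add hr, show a + n - 1 = (a - 1) + n by ring,
      Real.rpow_add h, Real.rpow_natCast, Real.rpow_natCast]
    have h2 := Real.Gamma_pos_of_pos ha
    have h3 := rising_pos ha n
    congr 1
    field_simp

theorem integrable_pow_gammaMeasure {a r : ℝ} (ha : 0 < a) (hr : 0 < r) (n : ℕ) :
    Integrable (fun z => z ^ n) (gammaMeasure a r) := by
  refine ⟨by fun_prop, ?_⟩
  rw [hasFiniteIntegral_iff_ofReal, lintegral_pow_gammaMeasure ha hr]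
  · exact ENNReal.ofReal_lt_top
  · filter_upwards [ae_gammaMeasure_nonneg a r] with z hz
    exact pow_nonneg hz n

theorem integral_pow_gammaMeasure {a r : ℝ} (ha : 0 < a) (hr : 0 < r) (n : ℕ) :
    ∫ z, z ^ n ∂gammaMeasure a r = rising a n / r ^ n := by
  rw [integral_eq_lintegral_of_nonneg_ae _ (by fun_prop), lintegral_pow_gammaMeasure ha hr,
    ENNReal.toReal_ofReal (by have := rising_pos ha n; positivity)]
  filter_upwards [ae_gammaMeasure_nonneg a r] with z hz
  exact pow_nonneg hz n

theorem gammaPi_one {d : ℕ} (α : Fin d → ℝ) :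
    gammaPi α 1 = Measure.pi fun i => gammaMeasure (α i) 1 := by
  simp [gammaPi, gammaScale]

theorem ae_gammaPi_nonneg {d : ℕ} {α : Fin d → ℝ} (hα : ∀ i, 0 < α i) :
    ∀ᵐ y ∂gammaPi α 1, ∀ i, 0 ≤ y i := by
  have (i : Fin d) := isProbabilityMeasure_gammaMeasure (hα i) one_pos
  rw [gammaPi_one, Filter.eventually_all]
  intro i
  exact (Measure.tendsto_eval_ae_ae (μ := fun i => gammaMeasure (α i) 1)).eventually
    (ae_gammaMeasure_nonneg (α i) 1)

theorem integral_eval_gammaPi {d : ℕ} {α : Fin d → ℝ} (hα : ∀ i, 0 < α i)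
    (f : MvPolynomial (Fin d) ℝ) :
    Integrable (fun y => eval y f) (gammaPi α 1) ∧
      ∫ y, eval y f ∂gammaPi α 1 = gammaFun α 1 f := by
  have (i : Fin d) := isProbabilityMeasure_gammaMeasure (hα i) one_pos
  rw [gammaPi_one]
  induction f using MvPolynomial.induction_on' with
  | monomial κ a =>
    have e : (fun y : Fin d → ℝ => eval y (monomial κ a)) = fun y => a * ∏ i, y i ^ κ i := by
      ext y
      rw [eval_monomial, Finsupp.prod_fintype _ _ (by simp)]
    rw [e]
    constructor
    · exact (Integrable.fintype_prod (f := fun i z => z ^ κ i)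
        fun i => integrable_pow_gammaMeasure (hα i) one_pos (κ i)).const_mul a
    · rw [integral_const_mul, integral_fintype_prod_eq_prod (fun i z => z ^ κ i),
        gammaFun_monomial]
      simp only [integral_pow_gammaMeasure (hα _) one_pos]
      simp
  | add f g hf hg =>
    simp only [map_add]
    exact ⟨hf.1.add hg.1, by rw [integral_add hf.1 hg.1, hf.2, hg.2]⟩

/-- The Gamma scale $p$ and the rescaling $(1-p)/p$ of the argument combine to the scale $1-p$. -/
theorem meixner_eq_sum {n : ℕ} {a p t : ℝ} (hat : 0 < a + t) (hp : 0 < p) :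
    meixner n a p t =
      ∑ i ∈ Finset.range (n + 1), laguerreCoeff n a i * (1 - p) ^ i * rising (a + t) i := by
  have hp' : 0 < p⁻¹ := inv_pos.2 hp
  rw [meixner, gammaScale]
  simp_rw [laguerre_eq_sum, mul_pow]
  rw [integral_finsetSum _ fun i _ =>
    ((integrable_pow_gammaMeasure hat hp' i).mul_const _).const_mul _]
  refine Finset.sum_congr rfl fun i _ => ?_
  rw [integral_const_mul, integral_mul_const, integral_pow_gammaMeasure hat hp', div_pow, inv_pow]
  field_simp

/-! ### The abstract duality -/

/-- Everything specific to the two systems enters through `hM`, `hM'` and `hne`: the mixture form of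
$M$, its dual form, and the nonvanishing of $L$ somewhere on the orthant. -/
theorem bernstein_expansion {d : ℕ} {α : Fin d → ℝ} (hα : ∀ i, 0 < α i) {p : ℝ}
    (hp0 : 0 < p) (hp1 : p < 1) {L : (Fin d → ℝ) → ℝ} {M : (Fin d → ℕ) → ℝ}
    {f : MvPolynomial (Fin d) ℝ} {R : ℕ}
    (hL : ∀ y, (∀ i, 0 ≤ y i) → L y = eval y f)
    (hM : ∀ m, M m = gammaFun (fun i => α i + m i) (1 - p) f)
    (hM' : ∀ m, M m = p ^ R * gammaFun (fun i => -(m i : ℝ)) (-((1 - p) / p)) f)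
    (hne : ∃ y, (∀ i, 0 ≤ y i) ∧ L y ≠ 0) {c ρ : ℝ}
    (hc : c = ∫ y, L y ^ 2 ∂(gammaPi α 1)) (hρ : ρ = (∑' m, negBinPi α p m * M m ^ 2)⁻¹) :
    (Integrable (fun y => L y ^ 2) (gammaPi α 1) ∧ 0 < c) ∧
    (Summable (fun m => negBinPi α p m * M m ^ 2) ∧ 0 < ρ) ∧
    ∀ l : Fin d → ℝ, (∀ i, 0 ≤ l i) →
      HasSum
        (fun m : Fin d → ℕ =>
          c * ρ * (Real.exp (-∑ i, l i) / ((∑ i, m i).factorial : ℝ)) * (M m * bernsteinB l m))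
        (L (fun i => l i * ((1 - p) / p))) := by
  have hq : 0 < (1 - p) / p := div_pos (by linarith) hp0
  have hLf : (fun y => L y ^ 2) =ᵐ[gammaPi α 1] fun y => eval y (f * f) := by
    filter_upwards [ae_gammaPi_nonneg hα] with y hy
    rw [hL y hy, map_mul, sq]
  have hI := integral_eval_gammaPi hα (f * f)
  have hc' : c = gammaFun α 1 (f * f) := by rw [hc, integral_congr_ae hLf, hI.2]
  have hS : HasSum (fun m => negBinPi α p m * M m ^ 2) (p ^ R * c) := by
    rw [hc']
    refine ((hasSum_negBinPi_gammaFun hα hp0 hp1 f f).mul_left (p ^ R)).congr_fun fun m => ?_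
    have h1 := hM m
    have h2 := hM' m
    rw [sq]
    -- One factor of the square takes the mixture form and the other the dual form.
    nth_rewrite 1 [h1]
    rw [h2]
    ring
  have hP : ∀ l : Fin d → ℝ, (∀ i, 0 ≤ l i) → HasSum
      (fun m : Fin d → ℕ => (∏ i, Real.exp (-l i) * (l i ^ m i / (m i).factorial)) * M m)
      (p ^ R * L (fun i => l i * ((1 - p) / p))) := by
    intro l hl
    rw [hL _ fun i => mul_nonneg (hl i) hq.le]
    refine ((hasSum_poisson_gammaFun l hl hq.le f).mul_left (p ^ R)).congr_fun fun m => ?_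
    rw [hM' m]; ring
  have hw : ∀ m, 0 < negBinPi α p m := fun m => Finset.prod_pos fun i _ => by
    have h1 := rising_pos (hα i) (m i)
    have h2 : 0 < (1 - p) ^ α i := Real.rpow_pos_of_pos (by linarith) _
    rw [negBin]
    positivity
  have hR : 0 < p ^ R := pow_pos hp0 R
  have hc0 : 0 ≤ c := by rw [hc]; exact integral_nonneg fun y => sq_nonneg _
  -- If $c=0$, the nonnegative terms of `hS` all vanish, so $M=0$; then `hP`, at the point rescaled
  -- to hit $y$, forces $L(y)=0$.
  have hcpos : 0 < c := by
    rcases hc0.eq_or_lt with h | h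
    · exfalso
      rw [← h, mul_zero] at hS
      have h0 := (hasSum_zero_iff_of_nonneg fun m => mul_nonneg (hw m).le (sq_nonneg (M m))).1 hS
      have hM0 : ∀ m, M m = 0 := fun m => by
        have := congrFun h0 m
        simpa [(hw m).ne'] using this
      obtain ⟨y, hy, hy0⟩ := hne
      have h1 := hP (fun i => y i / ((1 - p) / p)) fun i => div_nonneg (hy i) hq.le
      simp only [hM0, mul_zero, div_mul_cancel₀ _ hq.ne'] at h1
      have := h1.unique hasSum_zero
      simp [hR.ne', hy0] at this
    · exact h
  have hρ' : ρ = (p ^ R * c)⁻¹ := by rw [hρ, hS.tsum_eq]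
  refine ⟨⟨hI.1.congr hLf.symm, hcpos⟩, ⟨hS.summable, by rw [hρ']; positivity⟩, fun l hl => ?_⟩
  have h1 := (hP l hl).mul_left (c * ρ)
  have hcρ : c * ρ * p ^ R = 1 := by rw [hρ']; field_simp
  rw [← mul_assoc (c * ρ), hcρ, one_mul] at h1
  refine h1.congr_fun fun m => ?_
  have h2 := Nat.multinomial_spec Finset.univ m
  have h3 : ((∑ i, m i).factorial : ℝ) =
      (∏ i, ((m i).factorial : ℝ)) * (Nat.multinomial Finset.univ m : ℝ) := by
    rw [← h2]; push_cast; rfl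
  have h4 : (∏ i, ((m i).factorial : ℝ)) ≠ 0 :=
    Finset.prod_ne_zero_iff.2 fun i _ => Nat.cast_ne_zero.2 (m i).factorial_ne_zero
  have h5 := Nat.cast_ne_zero (R := ℝ).2 (∑ i, m i).factorial_ne_zero
  have h6 : (Nat.multinomial Finset.univ m : ℝ) ≠ 0 := by
    intro h; rw [h, mul_zero] at h3; exact h5 h3
  -- Dividing the multinomial coefficient by $|m|!$ leaves $\prod_i 1/m_i!$, so the Bernstein weight
  -- is the product Poisson mass.
  rw [bernsteinB, Finset.prod_mul_distrib, Finset.prod_div_distrib, ← Real.exp_sum,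
    Finset.sum_neg_distrib, h3]
  field_simp

/-! ### Dirichlet integrals -/

theorem setLIntegral_beta {a b t : ℝ} (ha : 0 < a) (hb : 0 < b) (ht : 0 < t) :
    ∫⁻ x in Set.Ioo 0 t, ENNReal.ofReal (x ^ (a - 1) * (t - x) ^ (b - 1)) =
      ENNReal.ofReal (Real.Gamma a * Real.Gamma b / Real.Gamma (a + b) * t ^ (a + b - 1)) := by
  have hB := beta_pos ha hb
  have h1 : ∫⁻ x in Set.Ioo (0 : ℝ) 1, ENNReal.ofReal (x ^ (a - 1) * (1 - x) ^ (b - 1)) =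
      ENNReal.ofReal (beta a b) := by
    have h := lintegral_betaPDF_eq_one ha hb
    rw [lintegral_betaPDF] at h
    have e : ∀ x : ℝ, ENNReal.ofReal (1 / beta a b * x ^ (a - 1) * (1 - x) ^ (b - 1)) =
        ENNReal.ofReal (1 / beta a b) * ENNReal.ofReal (x ^ (a - 1) * (1 - x) ^ (b - 1)) := by
      intro x
      rw [mul_assoc, ENNReal.ofReal_mul (by positivity)]
    simp_rw [e] at h
    rw [lintegral_const_mul _ (by fun_prop)] at h
    have h2 := congrArg (ENNReal.ofReal (beta a b) * ·) h
    simp only [mul_one] at h2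
    rw [← mul_assoc, ← ENNReal.ofReal_mul hB.le, mul_one_div_cancel hB.ne', ENNReal.ofReal_one,
      one_mul] at h2
    exact h2
  rw [← lintegral_indicator measurableSet_Ioo] at h1 ⊢
  rw [← Real.smul_map_volume_mul_left ht.ne', lintegral_smul_measure, lintegral_map
    (Measurable.indicator (by fun_prop) measurableSet_Ioo) (by fun_prop), abs_of_pos ht]
  -- The substitution $x\mapsto tx$ reduces to the normalized Beta density; the Jacobian supplies
  -- the last factor $t$.
  have e : ∀ x : ℝ, (Set.Ioo 0 t).indicator
      (fun x => ENNReal.ofReal (x ^ (a - 1) * (t - x) ^ (b - 1))) (t * x) =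
      ENNReal.ofReal (t ^ (a + b - 2)) * (Set.Ioo 0 1).indicator
        (fun x => ENNReal.ofReal (x ^ (a - 1) * (1 - x) ^ (b - 1))) x := by
    intro x
    by_cases hx : x ∈ Set.Ioo (0 : ℝ) 1
    · have hx' : t * x ∈ Set.Ioo 0 t := ⟨mul_pos ht hx.1, by nlinarith [hx.2]⟩
      rw [Set.indicator_of_mem hx, Set.indicator_of_mem hx', ← ENNReal.ofReal_mul (by positivity),
        show t - t * x = t * (1 - x) by ring, Real.mul_rpow ht.le hx.1.le,
        Real.mul_rpow ht.le (by linarith [hx.2]), show a + b - 2 = (a - 1) + (b - 1) by ring,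
        Real.rpow_add ht]
      congr 1
      ring
    · have hx' : t * x ∉ Set.Ioo 0 t := fun h =>
        hx ⟨pos_of_mul_pos_right h.1 ht.le, by nlinarith [h.2]⟩
      rw [Set.indicator_of_notMem hx, Set.indicator_of_notMem hx', mul_zero]
  simp_rw [e]
  rw [lintegral_const_mul _ (Measurable.indicator (by fun_prop) measurableSet_Ioo), h1,
    smul_eq_mul, ← ENNReal.ofReal_mul (by positivity), ← ENNReal.ofReal_mul ht.le, beta,
    show a + b - 1 = (a + b - 2) + 1 by ring, Real.rpow_add ht, Real.rpow_one]
  congr 1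
  ring

/-- The simplex `{x : x_i ≥ 0, ∑ x_i ≤ t}`. -/
def scaledSimplex (k : ℕ) (t : ℝ) : Set (Fin k → ℝ) := {x | (∀ i, 0 ≤ x i) ∧ ∑ i, x i ≤ t}

theorem measurableSet_scaledSimplex (k : ℕ) (t : ℝ) : MeasurableSet (scaledSimplex k t) := by
  have h1 : MeasurableSet {x : Fin k → ℝ | ∀ i, 0 ≤ x i} := by
    simp only [Set.ofPred_forall]
    exact MeasurableSet.iInter fun i => measurableSet_le measurable_const (measurable_pi_apply i)
  have h2 : MeasurableSet {x : Fin k → ℝ | ∑ i, x i ≤ t} :=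
    measurableSet_le (by fun_prop) measurable_const
  exact h1.inter h2

/-- Liouville's formula for the Dirichlet integral. -/
theorem setLIntegral_dirichlet {k : ℕ} {a : Fin k → ℝ} (ha : ∀ i, 0 < a i) {b : ℝ} (hb : 0 < b)
    {t : ℝ} (ht : 0 < t) :
    ∫⁻ x in scaledSimplex k t,
        ENNReal.ofReal ((∏ i, x i ^ (a i - 1)) * (t - ∑ i, x i) ^ (b - 1)) =
      ENNReal.ofReal ((∏ i, Real.Gamma (a i)) * Real.Gamma b / Real.Gamma (∑ i, a i + b) *
        t ^ (∑ i, a i + b - 1)) := by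
  induction k generalizing t with
  | zero =>
    have : scaledSimplex 0 t = Set.univ := by
      ext x; simp [scaledSimplex, ht.le]
    have hG := (Real.Gamma_pos_of_pos hb).ne'
    simp [this, hG, Measure.volume_pi_eq_dirac (fun i : Fin 0 => i.elim0)]
  | succ k ih =>
    have hA : 0 ≤ ∑ i : Fin k, a i.succ := Finset.sum_nonneg fun i _ => (ha i.succ).le
    have hm : Measurable ((scaledSimplex (k + 1) t).indicator fun x =>
        ENNReal.ofReal ((∏ i, x i ^ (a i - 1)) * (t - ∑ i, x i) ^ (b - 1))) :=
      Measurable.indicator (by fun_prop) (measurableSet_scaledSimplex _ t)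
    rw [← lintegral_indicator (measurableSet_scaledSimplex _ t),
      ← (volume_preserving_piFinSuccAbove (fun _ : Fin (k + 1) => ℝ) 0).symm.lintegral_comp
        hm, Measure.volume_eq_prod, lintegral_prod _ (by fun_prop)]
    -- The fibre over the first coordinate $u$ is the simplex of size $t-u$, where the induction
    -- hypothesis applies; a Beta integral in $u$ remains. The endpoints $u=0,t$ are null and are
    -- dropped.
    have inner : ∀ᵐ u : ℝ, ∫⁻ v : Fin k → ℝ, (scaledSimplex (k + 1) t).indicator
        (fun x => ENNReal.ofReal ((∏ i, x i ^ (a i - 1)) * (t - ∑ i, x i) ^ (b - 1)))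
        ((MeasurableEquiv.piFinSuccAbove (fun _ : Fin (k + 1) => ℝ) 0).symm (u, v)) =
        (Set.Ioo 0 t).indicator (fun u => ENNReal.ofReal ((∏ i : Fin k, Real.Gamma (a i.succ)) *
          Real.Gamma b / Real.Gamma (∑ i : Fin k, a i.succ + b)) *
          ENNReal.ofReal (u ^ (a 0 - 1) * (t - u) ^ (∑ i : Fin k, a i.succ + b - 1))) u := by
      have h0 : ∀ᵐ u : ℝ, u ≠ 0 := by simp [ae_iff]
      have h1 : ∀ᵐ u : ℝ, u ≠ t := by simp [ae_iff]
      filter_upwards [h0, h1] with u hu0 hut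
      have e : ∀ v : Fin k → ℝ, (MeasurableEquiv.piFinSuccAbove (fun _ : Fin (k + 1) => ℝ) 0).symm
          (u, v) = Fin.cons u v := by
        intro v
        simp [MeasurableEquiv.piFinSuccAbove, Fin.insertNthEquiv]
      simp_rw [e]
      have hmem : ∀ v : Fin k → ℝ, (Fin.cons u v : Fin (k + 1) → ℝ) ∈ scaledSimplex (k + 1) t ↔
          0 ≤ u ∧ v ∈ scaledSimplex k (t - u) := by
        intro v
        simp only [scaledSimplex, Set.mem_ofPred_eq, Fin.forall_fin_succ, Fin.cons_zero,
          Fin.cons_succ, Fin.sum_univ_succ, le_sub_iff_add_le', and_assoc]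
      by_cases hu : u ∈ Set.Ioo 0 t
      · rw [Set.indicator_of_mem hu]
        have hf : ∀ v : Fin k → ℝ, (scaledSimplex (k + 1) t).indicator
            (fun x => ENNReal.ofReal ((∏ i, x i ^ (a i - 1)) * (t - ∑ i, x i) ^ (b - 1)))
            (Fin.cons u v) = ENNReal.ofReal (u ^ (a 0 - 1)) *
            (scaledSimplex k (t - u)).indicator (fun v => ENNReal.ofReal
              ((∏ i, v i ^ (a i.succ - 1)) * (t - u - ∑ i, v i) ^ (b - 1))) v := by
          intro v
          by_cases hv : v ∈ scaledSimplex k (t - u)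
          · rw [Set.indicator_of_mem hv, Set.indicator_of_mem ((hmem v).2 ⟨hu.1.le, hv⟩),
              ← ENNReal.ofReal_mul (Real.rpow_nonneg hu.1.le _), Fin.prod_univ_succ,
              Fin.sum_univ_succ]
            simp only [Fin.cons_zero, Fin.cons_succ, mul_assoc, sub_sub]
          · rw [Set.indicator_of_notMem hv,
              Set.indicator_of_notMem fun h => hv ((hmem v).1 h).2, mul_zero]
        simp_rw [hf]
        rw [lintegral_const_mul _ (Measurable.indicator (by fun_prop)
          (measurableSet_scaledSimplex _ _)),
          lintegral_indicator (measurableSet_scaledSimplex _ _),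
          ih (fun i => ha i.succ) (sub_pos.2 hu.2), ← ENNReal.ofReal_mul
            (Real.rpow_nonneg hu.1.le _), ← ENNReal.ofReal_mul]
        · congr 1; ring
        · have := Finset.prod_nonneg fun (i : Fin k) (_ : i ∈ Finset.univ) => (Real.Gamma_pos_of_pos (ha i.succ)).le
          have := Real.Gamma_pos_of_pos hb
          have := Real.Gamma_pos_of_pos (show 0 < ∑ i : Fin k, a i.succ + b by positivity)
          positivity
      · rw [Set.indicator_of_notMem hu]
        have : ∀ v : Fin k → ℝ, (Fin.cons u v : Fin (k + 1) → ℝ) ∉ scaledSimplex (k + 1) t := by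
          intro v hv
          obtain ⟨h1, h2, h3⟩ := (hmem v).1 hv
          have h4 := Finset.sum_nonneg fun (i : Fin k) (_ : i ∈ Finset.univ) => h2 i
          exact hu ⟨lt_of_le_of_ne h1 hu0.symm, lt_of_le_of_ne (by linarith) hut⟩
        simp [Set.indicator_of_notMem (this _)]
    rw [lintegral_congr_ae inner, lintegral_indicator measurableSet_Ioo,
      lintegral_const_mul _ (by fun_prop), setLIntegral_beta (ha 0) (by positivity) ht,
      ← ENNReal.ofReal_mul, Fin.prod_univ_succ, Fin.sum_univ_succ,
      ← add_assoc (a 0)]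
    · have := (Real.Gamma_pos_of_pos (show 0 < ∑ i : Fin k, a i.succ + b by positivity)).ne'
      congr 1
      field_simp
    · have := Finset.prod_nonneg fun (i : Fin k) (_ : i ∈ Finset.univ) => (Real.Gamma_pos_of_pos (ha i.succ)).le
      have := Real.Gamma_pos_of_pos hb
      have := Real.Gamma_pos_of_pos (show 0 < ∑ i : Fin k, a i.succ + b by positivity)
      positivity

/-- The full set of `k + 1` barycentric coordinates of a point of the simplex. -/
noncomputable def barycentric {k : ℕ} (x : Fin k → ℝ) : Fin (k + 1) → ℝ :=
  Fin.snoc x (1 - ∑ i, x i)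

theorem barycentric_nonneg {k : ℕ} {x : Fin k → ℝ} (hx : x ∈ simplex k) (i : Fin (k + 1)) :
    0 ≤ barycentric x i := by
  refine Fin.lastCases ?_ (fun i => ?_) i
  · simpa [barycentric] using hx.2
  · simpa [barycentric] using hx.1 i

theorem sum_barycentric {k : ℕ} (x : Fin k → ℝ) : ∑ i, barycentric x i = 1 := by
  simp [Fin.sum_univ_castSucc, barycentric]

theorem measurable_dirichletDensity {k : ℕ} (α : Fin (k + 1) → ℝ) :
    Measurable fun x : Fin k → ℝ => ENNReal.ofReal
      (Real.Gamma (∑ i, α i) / (∏ i, Real.Gamma (α i)) *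
        (∏ i : Fin k, x i ^ (α i.castSucc - 1)) *
          (1 - ∑ i, x i) ^ (α (Fin.last k) - 1)) := by
  fun_prop

theorem ae_dirichlet_mem {k : ℕ} (α : Fin (k + 1) → ℝ) : ∀ᵐ x ∂dirichlet α, x ∈ simplex k := by
  have h : ∀ᵐ x ∂(volume.restrict (simplex k)), x ∈ simplex k :=
    ae_restrict_mem (measurableSet_scaledSimplex k 1)
  exact (withDensity_absolutelyContinuous _ _).ae_le h

/-- At $x=0$ with $n\ge1$ both sides vanish, because $0<a$ keeps the exponent $a+n-1$ away from
zero. -/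
theorem rpow_sub_one_mul_pow {x a : ℝ} (hx : 0 ≤ x) (ha : 0 < a) (n : ℕ) :
    x ^ (a - 1) * x ^ n = x ^ (a + n - 1) := by
  rcases hx.eq_or_lt with rfl | hx
  · rcases Nat.eq_zero_or_pos n with rfl | hn
    · simp
    · have h1 : (1 : ℝ) ≤ n := by exact_mod_cast hn
      rw [zero_pow hn.ne', mul_zero, Real.zero_rpow (by linarith)]
  · rw [show a + n - 1 = (a - 1) + n by ring, Real.rpow_add hx, Real.rpow_natCast]

theorem lintegral_monomial_dirichlet {k : ℕ} {α : Fin (k + 1) → ℝ} (hα : ∀ i, 0 < α i)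
    (κ : Fin (k + 1) → ℕ) :
    ∫⁻ x, ENNReal.ofReal (∏ i, barycentric x i ^ κ i) ∂dirichlet α =
      ENNReal.ofReal ((∏ i, rising (α i) (κ i)) / rising (∑ i, α i) (∑ i, κ i)) := by
  have hG := fun i => Real.Gamma_pos_of_pos (hα i)
  have hs : 0 < ∑ i, α i := Finset.sum_pos (fun i _ => hα i) Finset.univ_nonempty
  have hGs := Real.Gamma_pos_of_pos hs
  have hP := Finset.prod_pos fun i (_ : i ∈ Finset.univ) => hG i
  have hc : 0 ≤ Real.Gamma (∑ i, α i) / ∏ i, Real.Gamma (α i) := by positivity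
  have hκ : ∀ i, 0 < α i + κ i := fun i => by have := hα i; positivity
  have hm : Measurable fun x : Fin k → ℝ => ENNReal.ofReal (∏ i, barycentric x i ^ κ i) := by
    simp only [Fin.prod_univ_castSucc, barycentric, Fin.snoc_castSucc, Fin.snoc_last]
    fun_prop
  rw [dirichlet, lintegral_withDensity_eq_lintegral_mul _ (measurable_dirichletDensity α) hm]
  have e : ∫⁻ x in simplex k, ((fun x : Fin k → ℝ => ENNReal.ofReal
      (Real.Gamma (∑ i, α i) / (∏ i, Real.Gamma (α i)) *
        (∏ i : Fin k, x i ^ (α i.castSucc - 1)) * (1 - ∑ i, x i) ^ (α (Fin.last k) - 1))) *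
        fun x => ENNReal.ofReal (∏ i, barycentric x i ^ κ i)) x =
      ∫⁻ x in simplex k, ENNReal.ofReal (Real.Gamma (∑ i, α i) / (∏ i, Real.Gamma (α i))) *
        ENNReal.ofReal ((∏ i : Fin k, x i ^ ((α i.castSucc + κ i.castSucc) - 1)) *
          (1 - ∑ i, x i) ^ ((α (Fin.last k) + κ (Fin.last k)) - 1)) := by
    refine setLIntegral_congr_fun (measurableSet_scaledSimplex k 1) fun x hx => ?_
    have h0 : 0 ≤ 1 - ∑ i, x i := sub_nonneg.2 hx.2
    have h1 : 0 ≤ ∏ i : Fin k, x i ^ (α i.castSucc - 1) :=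
      Finset.prod_nonneg fun i _ => Real.rpow_nonneg (hx.1 i) _
    have h2 : 0 ≤ (1 - ∑ i, x i) ^ (α (Fin.last k) - 1) := Real.rpow_nonneg h0 _
    rw [Pi.mul_apply, ← ENNReal.ofReal_mul (by positivity), ← ENNReal.ofReal_mul hc,
      Fin.prod_univ_castSucc (fun i => barycentric x i ^ κ i),
      ← rpow_sub_one_mul_pow h0 (hα (Fin.last k)), Finset.prod_congr rfl fun i _ =>
        (rpow_sub_one_mul_pow (hx.1 i) (hα i.castSucc) (κ i.castSucc)).symm,
      Finset.prod_mul_distrib]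
    simp only [barycentric, Fin.snoc_castSucc, Fin.snoc_last]
    congr 1
    ring
  rw [e, lintegral_const_mul _ (by fun_prop)]
  have h := setLIntegral_dirichlet (fun i : Fin k => hκ i.castSucc) (hκ (Fin.last k)) one_pos
  rw [Real.one_rpow, mul_one] at h
  have hset : simplex k = scaledSimplex k 1 := rfl
  rw [hset, h, ← ENNReal.ofReal_mul hc]
  congr 1
  have h1 : ∑ i : Fin k, (α i.castSucc + (κ i.castSucc : ℝ)) + (α (Fin.last k) + κ (Fin.last k)) =
      ∑ i, α i + (∑ i, κ i : ℕ) := by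
    rw [← Fin.sum_univ_castSucc (fun i => α i + (κ i : ℝ)), Finset.sum_add_distrib]
    push_cast
    rfl
  have h2 : (∏ i : Fin k, Real.Gamma (α i.castSucc + (κ i.castSucc : ℝ))) *
      Real.Gamma (α (Fin.last k) + κ (Fin.last k)) =
      (∏ i, rising (α i) (κ i)) * ∏ i, Real.Gamma (α i) := by
    rw [← Fin.prod_univ_castSucc (fun i => Real.Gamma (α i + (κ i : ℝ))),
      ← Finset.prod_mul_distrib]
    exact Finset.prod_congr rfl fun i _ => Gamma_add_nat (hα i) _
  rw [h1, h2, Gamma_add_nat hs]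
  have := (rising_pos hs (∑ i, κ i)).ne'
  field_simp

theorem integral_monomial_dirichlet {k : ℕ} {α : Fin (k + 1) → ℝ} (hα : ∀ i, 0 < α i)
    (κ : Fin (k + 1) → ℕ) :
    Integrable (fun x => ∏ i, barycentric x i ^ κ i) (dirichlet α) ∧
      ∫ x, ∏ i, barycentric x i ^ κ i ∂dirichlet α =
        (∏ i, rising (α i) (κ i)) / rising (∑ i, α i) (∑ i, κ i) := by
  have hs : 0 < ∑ i, α i := Finset.sum_pos (fun i _ => hα i) Finset.univ_nonempty
  have hm : Measurable fun x : Fin k → ℝ => ∏ i, barycentric x i ^ κ i := by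
    simp only [Fin.prod_univ_castSucc, barycentric, Fin.snoc_castSucc, Fin.snoc_last]
    fun_prop
  have h0 : 0 ≤ᵐ[dirichlet α] fun x => ∏ i, barycentric x i ^ κ i := by
    filter_upwards [ae_dirichlet_mem α] with x hx
    exact Finset.prod_nonneg fun i _ => pow_nonneg (barycentric_nonneg hx i) _
  refine ⟨⟨hm.aestronglyMeasurable, ?_⟩, ?_⟩
  · rw [hasFiniteIntegral_iff_ofReal h0, lintegral_monomial_dirichlet hα]
    exact ENNReal.ofReal_lt_top
  · rw [integral_eq_lintegral_of_nonneg_ae h0 hm.aestronglyMeasurable,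
      lintegral_monomial_dirichlet hα, ENNReal.toReal_ofReal]
    exact div_nonneg (Finset.prod_nonneg fun i _ => (rising_pos (hα i) _).le) (rising_pos hs _).le

open MvPolynomial in
-- The denominator of a Dirichlet moment depends only on the total degree, so on a homogeneous
-- polynomial it factors out and the Gamma functional remains.
theorem integral_eval_dirichlet {k : ℕ} {α : Fin (k + 1) → ℝ} (hα : ∀ i, 0 < α i)
    {f : MvPolynomial (Fin (k + 1)) ℝ} {N : ℕ}
    (hf : IsWeightedHomogeneous (degOn Finset.univ) f N) :
    ∫ x, eval (barycentric x) f ∂dirichlet α = gammaFun α 1 f / rising (∑ i, α i) N := by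
  have e : (fun x : Fin k → ℝ => eval (barycentric x) f) =
      fun x => ∑ κ ∈ f.support, coeff κ f * ∏ i, barycentric x i ^ κ i := by
    ext x
    exact eval_eq' _ _
  have h2 : gammaFun α 1 f = ∑ κ ∈ f.support, coeff κ f * ∏ i, rising (α i) (κ i) := by
    conv_lhs => rw [← support_sum_monomial_coeff f]
    rw [map_sum]
    exact Finset.sum_congr rfl fun κ _ => by simp [gammaFun_monomial]
  have hi : ∀ κ ∈ f.support, Integrable
      (fun x : Fin k → ℝ => coeff κ f * ∏ i, barycentric x i ^ κ i) (dirichlet α) :=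
    fun κ _ => (integral_monomial_dirichlet hα κ).1.const_mul _
  rw [e, integral_finsetSum _ hi, h2, Finset.sum_div]
  refine Finset.sum_congr rfl fun κ hκ => ?_
  have h := hf (mem_support_iff.1 hκ)
  rw [weight_degOn] at h
  rw [integral_const_mul, (integral_monomial_dirichlet hα κ).2, h, mul_div_assoc]

/-- The denominator here is cancelled by the rising factorial in the definition of
`multiMeixnerStar`. -/
theorem multiHahn_eq {k : ℕ} {α : Fin (k + 1) → ℝ} (hα : ∀ i, 0 < α i) (n : Fin k → ℕ)
    (m : Fin (k + 1) → ℕ) :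
    multiHahn α n m = gammaFun (fun i => α i + m i) 1 (jacobiPoly α n) /
      rising (∑ i, (α i + m i)) (∑ j, n j) := by
  rw [multiHahn, ← integral_eval_dirichlet (fun i => by have := hα i; positivity)
    (isWeightedHomogeneous_jacobiPoly α n)]
  refine integral_congr_ae ?_
  filter_upwards [ae_dirichlet_mem _] with x hx
  rw [← multiJacobi_eq_eval hα n (barycentric_nonneg hx) (sum_barycentric x)]
  simp [barycentric]

open MvPolynomial

/-! ### The product system -/

/-- The product multiple Laguerre polynomial as a polynomial. -/
noncomputable def laguerrePoly {d : ℕ} (α : Fin d → ℝ) (n : Fin d → ℕ) : MvPolynomial (Fin d) ℝ :=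
  ∏ i, ∑ j ∈ Finset.range (n i + 1), C (laguerreCoeff (n i) (α i) j) * X i ^ j

theorem gammaFun_prod_sum {d : ℕ} (β : Fin d → ℝ) (t : ℝ) (n : Fin d → ℕ) (c : Fin d → ℕ → ℝ) :
    gammaFun β t (∏ i, ∑ j ∈ Finset.range (n i + 1), C (c i j) * X i ^ j) =
      ∏ i, ∑ j ∈ Finset.range (n i + 1), c i j * t ^ j * rising (β i) j := by
  rw [Finset.prod_univ_sum, Finset.prod_univ_sum, map_sum]
  refine Finset.sum_congr rfl fun κ _ => ?_
  have e : (∏ i, C (c i (κ i)) * X i ^ κ i : MvPolynomial (Fin d) ℝ) =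
      monomial (Finsupp.equivFunOnFinite.symm κ) (∏ i, c i (κ i)) := by
    rw [monomial_eq, Finsupp.prod_fintype _ _ (by simp), Finset.prod_mul_distrib, map_prod]
    simp
  rw [e, gammaFun_monomial, ← Finset.prod_mul_distrib]
  exact Finset.prod_congr rfl fun i _ => by simp [mul_assoc]

theorem eval_laguerrePoly {d : ℕ} (α : Fin d → ℝ) (n : Fin d → ℕ) (y : Fin d → ℝ) :
    eval y (laguerrePoly α n) = ∏ i, laguerre (n i) (α i) (y i) := by
  rw [laguerrePoly, map_prod]
  refine Finset.prod_congr rfl fun i _ => ?_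
  simp [laguerre_eq_sum]

/-! ### The system built on the multivariate Jacobi polynomials -/

/-- The multiple Laguerre polynomial built on the multivariate Jacobi polynomial, as a
polynomial. -/
noncomputable def laguerreStarPoly {k : ℕ} (α : Fin (k + 1) → ℝ) (n : Fin (k + 1) → ℕ) :
    MvPolynomial (Fin (k + 1)) ℝ :=
  ∑ i ∈ Finset.range (n (Fin.last k) + 1),
    laguerreCoeff (n (Fin.last k)) ((∑ i, α i) + 2 * ((∑ j : Fin k, n j.castSucc : ℕ) : ℝ)) i •
      ((∑ i, X i) ^ i * jacobiPoly α fun j => n j.castSucc)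

theorem single_last_nonneg {k : ℕ} (i : Fin (k + 1)) :
    0 ≤ (Pi.single (Fin.last k) 1 : Fin (k + 1) → ℝ) i := by
  rw [Pi.single_apply]
  split_ifs <;> norm_num

theorem pow_mul_multiJacobi {k : ℕ} {α : Fin (k + 1) → ℝ} (hα : ∀ i, 0 < α i) (n : Fin k → ℕ)
    {y : Fin (k + 1) → ℝ} (hy : ∀ i, 0 ≤ y i) :
    (∑ i, y i) ^ (∑ j, n j) * multiJacobi α n (fun j => y j.castSucc / ∑ i, y i) =
      eval y (jacobiPoly α n) := by
  have hH := isWeightedHomogeneous_jacobiPoly α n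
  rcases (Finset.sum_nonneg fun i (_ : i ∈ Finset.univ) => hy i).eq_or_lt with h | h
  · have hy0 : y = 0 := funext fun i =>
      (Finset.sum_eq_zero_iff_of_nonneg fun i _ => hy i).1 h.symm i (Finset.mem_univ i)
    -- At $y=0$ the quotients default to $0$, which are the first coordinates of the last vertex of
    -- the simplex. Scaling that vertex by $0$ gives the claim, including when the degree is $0$.
    have h1 : multiJacobi α n (fun j => y j.castSucc / ∑ i, y i) =
        eval (Pi.single (Fin.last k) 1) (jacobiPoly α n) := by
      rw [← multiJacobi_eq_eval hα n (y := Pi.single (Fin.last k) 1)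
        single_last_nonneg (by simp)]
      simp [hy0]
    rw [h1, ← h, ← eval_scale 0 _ hH, hy0]
    simp
  · rw [multiJacobi_eq_eval hα n (y := fun i => y i / ∑ i, y i)
      (fun i => div_nonneg (hy i) h.le) (by rw [← Finset.sum_div, div_self h.ne']),
      ← eval_scale _ _ hH]
    congr 2
    ext i
    field_simp

theorem eval_laguerreStarPoly {k : ℕ} {α : Fin (k + 1) → ℝ} (n : Fin (k + 1) → ℕ)
    (y : Fin (k + 1) → ℝ) :
    eval y (laguerreStarPoly α n) =
      laguerre (n (Fin.last k)) ((∑ i, α i) + 2 * ((∑ j : Fin k, n j.castSucc : ℕ) : ℝ))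
        (∑ i, y i) * eval y (jacobiPoly α fun j => n j.castSucc) := by
  rw [laguerreStarPoly, map_sum, laguerre_eq_sum, Finset.sum_mul]
  refine Finset.sum_congr rfl fun i _ => ?_
  simp [smul_eval, mul_assoc]

theorem gammaFun_laguerreStarPoly {k : ℕ} (α : Fin (k + 1) → ℝ) (n : Fin (k + 1) → ℕ)
    (β : Fin (k + 1) → ℝ) (t : ℝ) :
    gammaFun β t (laguerreStarPoly α n) =
      t ^ (∑ j : Fin k, n j.castSucc) * (∑ i ∈ Finset.range (n (Fin.last k) + 1),
        laguerreCoeff (n (Fin.last k))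
          ((∑ i, α i) + 2 * ((∑ j : Fin k, n j.castSucc : ℕ) : ℝ)) i * t ^ i *
          rising (∑ i, β i + ((∑ j : Fin k, n j.castSucc : ℕ) : ℝ)) i) *
        gammaFun β 1 (jacobiPoly α fun j => n j.castSucc) := by
  have hH := isWeightedHomogeneous_jacobiPoly α fun j => n j.castSucc
  rw [laguerreStarPoly, map_sum, Finset.mul_sum, Finset.sum_mul]
  refine Finset.sum_congr rfl fun i _ => ?_
  rw [map_smul, gammaFun_sum_X_pow_mul β t _ hH, gammaFun_scale β t hH, smul_eq_mul]
  ring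

/-- The witness is a small positive multiple $t$ of the last unit vector. Each Jacobi factor reduces
to its pure $v^n$ term, and the Laguerre factor is near its positive value at $0$. The point $t=0$
itself fails when the Jacobi part has positive degree. -/
theorem exists_eval_laguerreStarPoly_ne_zero {k : ℕ} {α : Fin (k + 1) → ℝ} (hα : ∀ i, 0 < α i)
    (n : Fin (k + 1) → ℕ) : ∃ y, (∀ i, 0 ≤ y i) ∧ eval y (laguerreStarPoly α n) ≠ 0 := by
  set a := (∑ i, α i) + 2 * ((∑ j : Fin k, n j.castSucc : ℕ) : ℝ) with ha
  have hs : 0 < ∑ i, α i := Finset.sum_pos (fun i _ => hα i) Finset.univ_nonempty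
  have hcont : Continuous (laguerre (n (Fin.last k)) a) := by
    have : laguerre (n (Fin.last k)) a = fun y => ∑ i ∈ Finset.range (n (Fin.last k) + 1),
        laguerreCoeff (n (Fin.last k)) a i * y ^ i := funext fun y => laguerre_eq_sum _ _ _
    rw [this]
    fun_prop
  have hev : ∀ᶠ t in nhdsWithin (0 : ℝ) (Set.Ioi 0), 0 < laguerre (n (Fin.last k)) a t :=
    nhdsWithin_le_nhds (hcont.continuousAt.eventually_const_lt
      (laguerre_zero_pos _ (by rw [ha]; positivity)))
  obtain ⟨t, ht, ht0⟩ := (hev.and self_mem_nhdsWithin).exists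
  have ht0 : 0 < t := ht0
  refine ⟨fun i => t * (Pi.single (Fin.last k) 1 : Fin (k + 1) → ℝ) i,
    fun i => mul_nonneg ht0.le (single_last_nonneg i), ?_⟩
  have hone : ∑ i, (Pi.single (Fin.last k) 1 : Fin (k + 1) → ℝ) i = 1 := by simp
  rw [eval_laguerreStarPoly, ← Finset.mul_sum, eval_scale _ _
    (isWeightedHomogeneous_jacobiPoly α fun j => n j.castSucc)]
  refine mul_ne_zero (by rw [hone, mul_one]; exact ht.ne') (mul_ne_zero (pow_pos ht0 _).ne' ?_)
  rw [eval_jacobiPoly]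
  refine Finset.prod_ne_zero_iff.2 fun j _ => ?_
  have h1 : ∑ i ∈ Finset.Ioi j.castSucc, (Pi.single (Fin.last k) 1 : Fin (k + 1) → ℝ) i = 1 := by
    rw [Finset.sum_eq_single (Fin.last k)]
    · simp
    · intro i _ hi
      simp [hi]
    · intro h
      simp [Fin.castSucc_lt_last] at h
  rw [h1, Pi.single_eq_of_ne (Fin.castSucc_lt_last j).ne]
  exact jacobiHom_zero_left_ne_zero _ (hα _) (jacobiParam_pos hα _ j)

theorem multiMeixnerStar_eq {k : ℕ} {α : Fin (k + 1) → ℝ} (hα : ∀ i, 0 < α i) {p : ℝ}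
    (hp0 : 0 < p) (n m : Fin (k + 1) → ℕ) :
    multiMeixnerStar α p n m =
      gammaFun (fun i => α i + m i) (1 - p) (laguerreStarPoly α n) := by
  have hs : 0 < ∑ i, α i := Finset.sum_pos (fun i _ => hα i) Finset.univ_nonempty
  have hm : ∑ i, (α i + (m i : ℝ)) = ∑ i, α i + ((∑ i, m i : ℕ) : ℝ) := by
    rw [Finset.sum_add_distrib]; push_cast; rfl
  have hpos : 0 < ∑ i, α i + ((∑ i, m i : ℕ) : ℝ) := by positivity
  -- The argument $|m|-|n'|$ leaves the Gamma shape $|\alpha|+|m|+|n'|$, the shape produced by a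
  -- Jacobi factor of degree $|n'|$.
  have e : (∑ i, α i) + 2 * ((∑ j : Fin k, n j.castSucc : ℕ) : ℝ) +
      (((∑ i, m i : ℕ) : ℝ) - ((∑ j : Fin k, n j.castSucc : ℕ) : ℝ)) =
      ∑ i, α i + ((∑ i, m i : ℕ) : ℝ) + ((∑ j : Fin k, n j.castSucc : ℕ) : ℝ) := by ring
  rw [multiMeixnerStar, multiHahn_eq hα, meixner_eq_sum (by rw [e]; positivity) hp0,
    gammaFun_laguerreStarPoly, hm, e]
  have := (rising_pos hpos (∑ j : Fin k, n j.castSucc)).ne'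
  field_simp

theorem multiMeixnerStar_eq_dual {k : ℕ} {α : Fin (k + 1) → ℝ} (hα : ∀ i, 0 < α i) {p : ℝ}
    (hp0 : 0 < p) (n m : Fin (k + 1) → ℕ) :
    multiMeixnerStar α p n m = p ^ (∑ i, n i) *
      gammaFun (fun i => -(m i : ℝ)) (-((1 - p) / p)) (laguerreStarPoly α n) := by
  have hs : 0 < ∑ i, α i := Finset.sum_pos (fun i _ => hα i) Finset.univ_nonempty
  have h := meixner_duality (n (Fin.last k))
    (a := (∑ i, α i) + 2 * ((∑ j : Fin k, n j.castSucc : ℕ) : ℝ)) (by positivity) hp0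
    (((∑ i, m i : ℕ) : ℝ) - ((∑ j : Fin k, n j.castSucc : ℕ) : ℝ))
  have e1 : ∑ i, (α i + (m i : ℝ)) + ((∑ j : Fin k, n j.castSucc : ℕ) : ℝ) =
      (∑ i, α i) + 2 * ((∑ j : Fin k, n j.castSucc : ℕ) : ℝ) +
      (((∑ i, m i : ℕ) : ℝ) - ((∑ j : Fin k, n j.castSucc : ℕ) : ℝ)) := by
    rw [Finset.sum_add_distrib]; push_cast; ring
  have e2 : ∑ i, -(m i : ℝ) + ((∑ j : Fin k, n j.castSucc : ℕ) : ℝ) =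
      -(((∑ i, m i : ℕ) : ℝ) - ((∑ j : Fin k, n j.castSucc : ℕ) : ℝ)) := by
    rw [Finset.sum_neg_distrib]; push_cast; ring
  -- The sign $(-1)^{|n'|}$ of the Jacobi duality cancels the sign of $(-(1-p)/p)^{|n'|}$; the
  -- powers $p^{n_d}$ and $p^{|n'|}$ combine to $p^{|n|}$.
  rw [multiMeixnerStar_eq hα hp0, gammaFun_laguerreStarPoly, gammaFun_laguerreStarPoly, e1, e2, h,
    gammaFun_jacobiPoly_duality hα (fun j => n j.castSucc) (fun i => (m i : ℝ)),
    Fin.sum_univ_castSucc n, pow_add, neg_pow ((1 - p) / p) (∑ j : Fin k, n j.castSucc), div_pow]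
  generalize (∑ i ∈ Finset.range (n (Fin.last k) + 1), (_ : ℝ)) = S
  field_simp

end MultiPoly

/-! ### The expansion for both systems -/

theorem corollary6p3 (k : ℕ) (α : Fin (k + 1) → ℝ) (hα : ∀ i, 0 < α i)
    (p : ℝ) (hp0 : 0 < p) (hp1 : p < 1)
    (L : (Fin (k + 1) → ℕ) → (Fin (k + 1) → ℝ) → ℝ)
    (M : (Fin (k + 1) → ℕ) → (Fin (k + 1) → ℕ) → ℝ)
    (hLM : (L = MultiPoly.multiLaguerre α ∧ M = MultiPoly.multiMeixner α p) ∨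
      (L = MultiPoly.multiLaguerreStar α ∧ M = MultiPoly.multiMeixnerStar α p))
    (r : Fin (k + 1) → ℕ) (c ρ : ℝ)
    (hc : c = ∫ y, L r y ^ 2 ∂(MultiPoly.gammaPi α 1))
    (hρ : ρ = (∑' m, MultiPoly.negBinPi α p m * M r m ^ 2)⁻¹) :
    (Integrable (fun y => L r y ^ 2) (MultiPoly.gammaPi α 1) ∧ 0 < c) ∧
    (Summable (fun m => MultiPoly.negBinPi α p m * M r m ^ 2) ∧ 0 < ρ) ∧
    ∀ l : Fin (k + 1) → ℝ, (∀ i, 0 ≤ l i) →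
      HasSum
        (fun m : Fin (k + 1) → ℕ =>
          c * ρ * (Real.exp (-∑ i, l i) / ((∑ i, m i).factorial : ℝ)) *
            (M r m * MultiPoly.bernsteinB l m))
        (L r (fun i => l i * ((1 - p) / p))) := by
  rcases hLM with ⟨rfl, rfl⟩ | ⟨rfl, rfl⟩
  -- For the product system the origin serves as the nonvanishing point, since every Laguerre factor
  -- is positive there.
  · refine MultiPoly.bernstein_expansion (f := MultiPoly.laguerrePoly α r) (R := ∑ i, r i) hα hp0
      hp1 ?_ ?_ ?_ ⟨0, fun i => le_rfl, ?_⟩ hc hρ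
    · intro y _
      rw [MultiPoly.eval_laguerrePoly, MultiPoly.multiLaguerre]
    · intro m
      rw [MultiPoly.laguerrePoly, MultiPoly.gammaFun_prod_sum, MultiPoly.multiMeixner]
      exact Finset.prod_congr rfl fun i _ =>
        MultiPoly.meixner_eq_sum (by have := hα i; positivity) hp0
    · intro m
      rw [MultiPoly.laguerrePoly, MultiPoly.gammaFun_prod_sum, MultiPoly.multiMeixner,
        ← Finset.prod_pow_eq_pow_sum, ← Finset.prod_mul_distrib]
      refine Finset.prod_congr rfl fun i _ => ?_
      rw [MultiPoly.meixner_eq_sum (by have := hα i; positivity) hp0,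
        MultiPoly.meixner_duality _ (hα i) hp0]
    · exact Finset.prod_ne_zero_iff.2 fun i _ => (MultiPoly.laguerre_zero_pos _ (hα i)).ne'
  · have hL : ∀ y : Fin (k + 1) → ℝ, (∀ i, 0 ≤ y i) → MultiPoly.multiLaguerreStar α r y =
        MvPolynomial.eval y (MultiPoly.laguerreStarPoly α r) := by
      intro y hy
      rw [MultiPoly.eval_laguerreStarPoly, MultiPoly.multiLaguerreStar, mul_assoc,
        MultiPoly.pow_mul_multiJacobi hα (fun j => r j.castSucc) hy]
    obtain ⟨y, hy, hy0⟩ := MultiPoly.exists_eval_laguerreStarPoly_ne_zero hα r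
    exact MultiPoly.bernstein_expansion hα hp0 hp1 hL
      (MultiPoly.multiMeixnerStar_eq hα hp0 r) (MultiPoly.multiMeixnerStar_eq_dual hα hp0 r)
      ⟨y, hy, by rwa [hL y hy]⟩ hc hρ
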